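/- Let $0<a<m$ and let $M=S^1\times\mathbb R\times\mathbb R^2$ with coordinates $\nu\in S^1=\mathbb R/2\pi\mathbb Z$, $r\in\mathbb R$, and pseudo spherical polar coordinates $(\theta,\phi)$, $\theta\ge 0$, on $\mathbb R^2$, i.e. $(x,y)=(\sinh\theta\cos\phi,\sinh\theta\sin\phi)$. Put $\rho^2=r^2+a^2\cosh^2\theta$, $\Delta(r)=r^2-2mr+a^2$, $r_1=m+\sqrt{m^2-a^2}$. The pseudo Kerr spacetime is $M$ with the Lorentzian metric (signature $(-+++)$) $$g=\Big(1-\frac{2mr}{\rho^2}\Big)d\nu^2-2\,d\nu\,dr-\frac{4mar}{\rho^2}\sinh^2\theta\,d\nu\,d\phi-2a\sinh^2\theta\,dr\,d\phi+\rho^2d\theta^2+\Big(r^2+a^2-\frac{2ma^2r}{\rho^2}\sinh^2\theta\Big)\sinh^2\theta\,d\phi^2,$$ extended smoothly over $\theta=0$, and with the time orientation for which the timelike field $-\partial_{\bar r}=-\big(\partial_r+\frac{r^2+a^2}{\Delta}\partial_\nu+\frac a\Delta\partial_\phi\big)$ is future pointing on the region $R_I=\{r>r_1\}$. For a spacetime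 $N$ let $\mathcal V(N)$ be the set of points lying on closed causal curves, and for $A\subset N$ let $D^+(A)$, the future domain of dependence, be the set of points $p$ such that every past pointing, past inextendible causal curve starting at $p$ meets $A$. One says that $N$ has time machine structure if there are an open set $U\subset N$ with $U\cap\mathcal V(N)=\emptyset$, a spacelike hypersurface $\mathscr S\subset U$, and an achronal compact set $\mathscr C\subset\mathscr S$ with $\overline{D^+(\mathscr C)}\cap\mathcal V(N)\ne\emptyset$. The pseudo Kerr spacetime has time machine structure. More precisely: 1. $R_I$ is open and $R_I\cap\mathcal V(M)=\emptyset$. 2. For every $\nu_0\in S^1$ the curve $s\mapsto(\nu_0+s,\,r_1,\,o)$, $0\le s\le 2\pi$, where $o$ is the point $\theta=0$, is a closed null curve contained in the horizon $H_1=\{r=r_1\}$ and in $\mathcal V(M)$. 3. For every $r_s>r_1$ the set $\{r=r_s\}$ is a spacelike hypersurface contained in $R_I$, and for every $$\theta_0>\ln\frac{r_s-m+\sqrt{\Delta(r_s)}}{r_1-m}$$ the set $\mathscr C=\{r=r_s,\ \theta\le\theta_0\}$ is a compact achronal subset of it such that $\overline{D^+(\mathscr C)}$ meets each of the closed null curves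 in 2. -/

import Mathlib

noncomputable section

namespace TimeMachine

open scoped Manifold ContDiff Topology
open Set

/-! ## Spacetimes and their causal structure -/

section Causality

variable {E : Type*} [NormedAddCommGroup E] [NormedSpace ℝ E]
  {H : Type*} [TopologicalSpace H]

/-- A spacetime: a connected Hausdorff second countable smooth four-manifold `M` without boundary,
with a smooth Lorentzian metric of signature `(-,+,+,+)` and a time orientation, the latter given
by a smooth timelike vector field which is declared to be future pointing.
(A symmetric bilinear form has signature `(-,+,…,+)` iff it is positive definite on the orthogonal
complement of a vector on which it is negative.) -/
structure Spacetime (I : ModelWithCorners ℝ E H) (M : Type*) [TopologicalSpace M]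
    [ChartedSpace H M] [IsManifold I ∞ M] [I.Boundaryless] [T2Space M]
    [SecondCountableTopology M] [ConnectedSpace M] where
  dim_eq_four : Module.finrank ℝ E = 4
  /-- the metric tensor -/
  metric (p : M) : TangentSpace I p →L[ℝ] TangentSpace I p →L[ℝ] ℝ
  metric_symm (p : M) (v w : TangentSpace I p) : metric p v w = metric p w v
  metric_smooth : ContMDiff I (I.prod 𝓘(ℝ, E →L[ℝ] E →L[ℝ] ℝ)) ∞
    (fun p : M ↦ Bundle.TotalSpace.mk' (E →L[ℝ] E →L[ℝ] ℝ)
      (E := fun p : M ↦ TangentSpace I p →L[ℝ] TangentSpace I p →L[ℝ] ℝ) p (metric p))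
  /-- the vector field that defines the time orientation -/
  timeField (p : M) : TangentSpace I p
  timeField_smooth : ContMDiff I (I.prod 𝓘(ℝ, E)) ∞
    (fun p : M ↦ Bundle.TotalSpace.mk' E (E := fun p : M ↦ TangentSpace I p) p (timeField p))
  timeField_timelike (p : M) : metric p (timeField p) (timeField p) < 0
  posDef_orthogonal (p : M) (v : TangentSpace I p) :
    metric p (timeField p) v = 0 → v ≠ 0 → 0 < metric p v v

variable {I : ModelWithCorners ℝ E H} {M : Type*} [TopologicalSpace M] [ChartedSpace H M]

/-- The curve `α`, restricted to the interval `J`, is continuous and piecewise smooth: around every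
parameter it is smooth on a one-sided closed interval to the right and on one to the left
(with one-sided derivatives of all orders at the ends). -/
def IsPiecewiseSmoothOn (I : ModelWithCorners ℝ E H) (α : ℝ → M) (J : Set ℝ) : Prop :=
  ∀ t ∈ J, ∃ ε > 0, ContMDiffOn 𝓘(ℝ, ℝ) I ∞ α (J ∩ Icc t (t + ε)) ∧
    ContMDiffOn 𝓘(ℝ, ℝ) I ∞ α (J ∩ Icc (t - ε) t)

/-- The right velocity of a curve. -/
def velRight (I : ModelWithCorners ℝ E H) (α : ℝ → M) (t : ℝ) : TangentSpace I (α t) :=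
  mfderivWithin 𝓘(ℝ, ℝ) I α (Ici t) t (1 : ℝ)

/-- The left velocity of a curve. -/
def velLeft (I : ModelWithCorners ℝ E H) (α : ℝ → M) (t : ℝ) : TangentSpace I (α t) :=
  mfderivWithin 𝓘(ℝ, ℝ) I α (Iic t) t (1 : ℝ)

/-- `α` is a piecewise smooth curve on the interval `J` all of whose velocity vectors (both of the
one-sided ones, wherever they make sense in `J`) satisfy `P`. -/
def IsCurveOfType (P : ∀ p : M, TangentSpace I p → Prop) (α : ℝ → M) (J : Set ℝ) : Prop :=
  IsPiecewiseSmoothOn I α J ∧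
    ∀ t ∈ J, ((∃ u ∈ J, t < u) → P (α t) (velRight I α t)) ∧
      ((∃ u ∈ J, u < t) → P (α t) (velLeft I α t))

/-- The half-open interval `[0, B)`, where `0 < B ≤ ∞`. -/
def halfOpen (B : EReal) : Set ℝ := {t : ℝ | 0 ≤ t ∧ (t : EReal) < B}

/-- `q` is an endpoint of the curve `α : [0, B) → M`, i.e. the limit of `α t` as `t → B`. -/
def IsEndpoint (α : ℝ → M) (B : EReal) (q : M) : Prop :=
  ∀ U ∈ 𝓝 q, ∃ t₀ ∈ halfOpen B, ∀ t ∈ halfOpen B, t₀ ≤ t → α t ∈ U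

namespace Spacetime

variable [IsManifold I ∞ M] [I.Boundaryless] [T2Space M]
  [SecondCountableTopology M] [ConnectedSpace M] (S : Spacetime I M)

/-- A vector is null if it is a nonzero vector of length zero. -/
def IsNull (p : M) (v : TangentSpace I p) : Prop := v ≠ 0 ∧ S.metric p v v = 0

/-- Future pointing timelike vectors. -/
def IsFutureTimelike (p : M) (v : TangentSpace I p) : Prop :=
  S.metric p v v < 0 ∧ S.metric p (S.timeField p) v < 0

/-- Future pointing causal (timelike or null) vectors. -/
def IsFutureCausal (p : M) (v : TangentSpace I p) : Prop :=
  v ≠ 0 ∧ S.metric p v v ≤ 0 ∧ S.metric p (S.timeField p) v < 0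

/-- Past pointing causal (timelike or null) vectors. -/
def IsPastCausal (p : M) (v : TangentSpace I p) : Prop :=
  v ≠ 0 ∧ S.metric p v v ≤ 0 ∧ 0 < S.metric p (S.timeField p) v

/-- The causality violating region: all points that lie on some closed causal curve (future or past
pointing). -/
def causalityViolatingRegion : Set M :=
  {p | ∃ (α : ℝ → M) (s t : ℝ), s < t ∧ α s = α t ∧
    (IsCurveOfType S.IsFutureCausal α (Icc s t) ∨ IsCurveOfType S.IsPastCausal α (Icc s t)) ∧
    p ∈ α '' Icc s t}

/-- The causality condition holds on `U`. -/
def CausalityHoldsOn (U : Set M) : Prop := S.causalityViolatingRegion ∩ U = ∅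

/-- `α : [s, t] → M` is a closed null curve. -/
def IsClosedNullCurve (α : ℝ → M) (s t : ℝ) : Prop :=
  s < t ∧ α s = α t ∧ IsCurveOfType S.IsNull α (Icc s t)

/-- `p ≪ q`: some future pointing timelike curve runs from `p` to `q`. -/
def ChronologicallyPrecedes (p q : M) : Prop :=
  ∃ (α : ℝ → M) (s t : ℝ), s < t ∧ α s = p ∧ α t = q ∧
    IsCurveOfType S.IsFutureTimelike α (Icc s t)

/-- `A` is achronal: no two of its points (distinct or not) are joined by a timelike curve. -/
def IsAchronal (A : Set M) : Prop :=
  ∀ p ∈ A, ∀ q ∈ A, ¬ S.ChronologicallyPrecedes p q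

/-- The future domain of dependence `D⁺(A)`: all points `p` such that every past pointing causal
curve `α : [0, B) → M` with `α 0 = p` that is past inextendible (has no endpoint) meets `A`. -/
def futureDomainOfDependence (A : Set M) : Set M :=
  {p | ∀ (B : EReal) (α : ℝ → M), 0 < B → IsCurveOfType S.IsPastCausal α (halfOpen B) → α 0 = p →
    (¬ ∃ q, IsEndpoint α B q) → ∃ t ∈ halfOpen B, α t ∈ A}

/-- `A` is a spacelike hypersurface: an embedded submanifold of codimension one (locally the zero
set of a smooth function with nonvanishing differential) whose induced metric is positive
definite. -/
def IsSpacelikeHypersurface (A : Set M) : Prop :=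
  ∀ p ∈ A, ∃ U : Set M, IsOpen U ∧ p ∈ U ∧ ∃ f : M → ℝ, ContMDiffOn I 𝓘(ℝ, ℝ) ∞ f U ∧
    A ∩ U = {q ∈ U | f q = 0} ∧
    ∀ q ∈ A ∩ U, mfderiv I 𝓘(ℝ, ℝ) f q ≠ 0 ∧
      ∀ v : TangentSpace I q, v ≠ 0 → mfderiv I 𝓘(ℝ, ℝ) f q v = 0 → 0 < S.metric q v v

/-- Time machine structure: there are an open set `U` on which the causality condition holds, a
spacelike hypersurface `Σ ⊆ U`, and an achronal compact set `C ⊆ Σ` such that the closure of the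
future domain of dependence of `C` contains points at which causality is violated. -/
def HasTMStructure : Prop :=
  ∃ U : Set M, IsOpen U ∧ S.CausalityHoldsOn U ∧
    ∃ A : Set M, S.IsSpacelikeHypersurface A ∧ A ⊆ U ∧
      ∃ C : Set M, C ⊆ A ∧ S.IsAchronal C ∧ IsCompact C ∧
        (closure (S.futureDomainOfDependence C) ∩ S.causalityViolatingRegion).Nonempty

end Spacetime

end Causality

/-! ## The manifold `S¹ × ℝ³` -/

/-- The circle `ℝ / 2πℤ`. -/
abbrev S1 : Type := AddCircle (2 * Real.pi)

/-- The smooth structure of the circle: charts are the local inverses of `ℝ → ℝ / 2πℤ`. -/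
instance chartedSpaceS1 : ChartedSpace ℝ S1 :=
  (AddCircle.isLocalHomeomorph_coe (2 * Real.pi)).chartedSpace QuotientAddGroup.mk_surjective

lemma S1_chart_symm {e : OpenPartialHomeomorph S1 ℝ} (he : e ∈ atlas ℝ S1) :
    (e.symm : ℝ → S1) = fun x : ℝ => (x : S1) := by
  obtain ⟨q, rfl⟩ := he
  ext x
  exact congrFun ((AddCircle.isLocalHomeomorph_coe (2 * Real.pi)).localInverseAt_symm _) x

lemma S1_transition {e e' : OpenPartialHomeomorph S1 ℝ} (he : e ∈ atlas ℝ S1)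
    (he' : e' ∈ atlas ℝ S1) {x : ℝ} (hx : x ∈ (e.symm ≫ₕ e').source) :
    ∃ c : ℝ, (e.symm ≫ₕ e' : ℝ → ℝ) =ᶠ[𝓝 x] fun y => y + c := by
  have key : ∀ y ∈ (e.symm ≫ₕ e').source, (((e.symm ≫ₕ e') y : ℝ) : S1) = (y : S1) := by
    intro y hy
    have h1 : e.symm y ∈ e'.source := by
      rw [OpenPartialHomeomorph.trans_source] at hy
      exact hy.2
    have h2 := e'.left_inv h1
    rw [S1_chart_symm he', S1_chart_symm he] at h2
    simpa [S1_chart_symm he] using h2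
  have hp := Real.two_pi_pos
  have hcont : ContinuousAt (fun y => (e.symm ≫ₕ e') y - y) x :=
    ((e.symm ≫ₕ e').continuousAt hx).sub continuousAt_id
  have hnear := Metric.continuousAt_iff'.1 hcont (2 * Real.pi) hp
  refine ⟨(e.symm ≫ₕ e') x - x, ?_⟩
  filter_upwards [hnear, (e.symm ≫ₕ e').open_source.mem_nhds hx] with y hy hys
  have h1 : (((e.symm ≫ₕ e') y - y - ((e.symm ≫ₕ e') x - x) : ℝ) : S1) = 0 := by
    rw [AddCircle.coe_sub, AddCircle.coe_sub, AddCircle.coe_sub, key y hys, key x hx]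
    simp
  obtain ⟨n, hn⟩ := AddCircle.coe_eq_zero_iff _ |>.1 h1
  rw [Real.dist_eq, ← hn] at hy
  have : n = 0 := by
    by_contra hne
    have : (1 : ℝ) ≤ |(n : ℝ)| := by exact_mod_cast Int.one_le_abs hne
    rw [zsmul_eq_mul, abs_mul, abs_of_pos hp] at hy
    nlinarith
  rw [this] at hn
  rw [zero_smul] at hn
  linarith

instance isManifoldS1 : IsManifold 𝓘(ℝ, ℝ) ∞ S1 := by
  refine isManifold_of_contDiffOn _ _ _ fun e e' he he' x hx => ?_
  simp only [modelWithCornersSelf_coe, modelWithCornersSelf_coe_symm, Function.id_comp,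
    Function.comp_id, preimage_id, range_id, inter_univ] at hx ⊢
  obtain ⟨c, hc⟩ := S1_transition he he' hx
  exact (((contDiff_id.add contDiff_const).contDiffAt).congr_of_eventuallyEq hc).contDiffWithinAt

/-- The manifold `M = S¹ × ℝ³`; a point is `(ν, r, x, y)`, where
`(x, y) = (sinh θ cos φ, sinh θ sin φ)` represents a point of the hyperbolic plane in pseudo
spherical polar coordinates `(θ, φ)`. -/
abbrev M4 : Type := S1 × ℝ × ℝ × ℝ

/-- The model vector space of `M = S¹ × ℝ³`. The tangent space at every point is this space, and
`(v₀, v₁, v₂, v₃)` stands for `v₀ ∂_ν + v₁ ∂_r + v₂ ∂_x + v₃ ∂_y`. -/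
abbrev E4 : Type := ℝ × ℝ × ℝ × ℝ

/-- The model with corners of `M = S¹ × ℝ³` (a manifold without boundary). -/
abbrev I4 : ModelWithCorners ℝ E4 (ModelProd ℝ (ℝ × ℝ × ℝ)) := 𝓘(ℝ, ℝ).prod 𝓘(ℝ, ℝ × ℝ × ℝ)

lemma M4_coordChange (p q z : M4) (hp : z ∈ (extChartAt I4 p).source)
    (hq : z ∈ (extChartAt I4 q).source) :
    tangentCoordChange I4 p q z = ContinuousLinearMap.id ℝ E4 := by
  have hs : ∀ w : M4, z ∈ (extChartAt I4 w).source → z.1 ∈ (chartAt ℝ w.1).source := by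
    intro w hw
    have : z ∈ (chartAt (ModelProd ℝ (ℝ × ℝ × ℝ)) w).source := by simpa using hw
    exact this.1
  have hx : (chartAt ℝ p.1) z.1 ∈ ((chartAt ℝ p.1).symm ≫ₕ (chartAt ℝ q.1)).source := by
    rw [OpenPartialHomeomorph.trans_source]
    refine ⟨(chartAt ℝ p.1).map_source (hs p hp), ?_⟩
    simpa [(chartAt ℝ p.1).left_inv (hs p hp)] using hs q hq
  obtain ⟨c, hc⟩ := S1_transition (chart_mem_atlas ℝ p.1) (chart_mem_atlas ℝ q.1) hx
  rw [tangentCoordChange_def, ModelWithCorners.range_eq_univ, fderivWithin_univ]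
  have : (extChartAt I4 q ∘ (extChartAt I4 p).symm) =ᶠ[𝓝 (extChartAt I4 p z)]
      fun v : E4 => v + (c, 0) := by
    have h2 := (continuous_fst (X := ℝ) (Y := ℝ × ℝ × ℝ)).continuousAt
      (x := extChartAt I4 p z) |>.eventually hc
    filter_upwards [h2] with v hv
    have h3 : (extChartAt I4 q ∘ (extChartAt I4 p).symm) v =
      ((chartAt ℝ q.1) ((chartAt ℝ p.1).symm v.1), v.2) := rfl
    rw [h3]
    exact Prod.ext hv (by simp)
  rw [this.fderiv_eq]
  simp

lemma M4_symmL (p z : M4) (hz : z ∈ (extChartAt I4 p).source) (v : E4) :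
    (trivializationAt E4 (TangentSpace I4) p).symm z v = v := by
  have hz' : z ∈ (chartAt (ModelProd ℝ (ℝ × ℝ × ℝ)) p).source := by simpa using hz
  have h := TangentBundle.symmL_trivializationAt_eq_core (I := I4) hz'
  have h2 := M4_coordChange p z z hz (mem_extChartAt_source z)
  rw [← Bundle.Trivialization.symmL_apply (R := ℝ) _ (by simpa using hz')]
  exact DFunLike.congr_fun (h.trans h2) v

lemma M4_trivialization (p z : M4) (hz : z ∈ (extChartAt I4 p).source) (v : E4) :
    (trivializationAt E4 (TangentSpace I4) p
      (Bundle.TotalSpace.mk' E4 (E := fun p : M4 ↦ TangentSpace I4 p) z v)).2 = v := by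
  have hz' : z ∈ (chartAt (ModelProd ℝ (ℝ × ℝ × ℝ)) p).source := by simpa using hz
  have h2 := M4_coordChange z p z (mem_extChartAt_source z) hz
  exact DFunLike.congr_fun h2 v

lemma M4_metric_smooth {g : M4 → E4 →L[ℝ] E4 →L[ℝ] ℝ}
    (hg : ContMDiff I4 𝓘(ℝ, E4 →L[ℝ] E4 →L[ℝ] ℝ) ∞ g) :
    ContMDiff I4 (I4.prod 𝓘(ℝ, E4 →L[ℝ] E4 →L[ℝ] ℝ)) ∞
    (fun p : M4 ↦ Bundle.TotalSpace.mk' (E4 →L[ℝ] E4 →L[ℝ] ℝ)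
      (E := fun p : M4 ↦ TangentSpace I4 p →L[ℝ] TangentSpace I4 p →L[ℝ] ℝ) p (g p)) := by
  intro p
  refine contMDiffAt_hom_bundle _ |>.2 ⟨contMDiffAt_id, (hg p).congr_of_eventuallyEq ?_⟩
  filter_upwards [(isOpen_extChartAt_source (I := I4) p).mem_nhds (mem_extChartAt_source p)]
    with z hz
  have hz' : z ∈ (chartAt (ModelProd ℝ (ℝ × ℝ × ℝ)) p).source := by simpa using hz
  refine ContinuousLinearMap.ext fun v => ContinuousLinearMap.ext fun w => ?_
  have key := inCoordinates_apply_eq₂ (F₁ := E4) (F₂ := E4) (F₃ := ℝ)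
    (E₁ := fun p : M4 ↦ TangentSpace I4 p) (E₂ := fun p : M4 ↦ TangentSpace I4 p)
    (E₃ := Bundle.Trivial M4 ℝ) (x₀ := p) (x := z) (ϕ := g z) (v := v) (w := w)
    hz' hz' (Set.mem_univ _)
  refine key.trans ?_
  rw [M4_symmL p z hz, M4_symmL p z hz]
  simp
  rfl

lemma M4_field_smooth {X : M4 → E4} (hX : ContMDiff I4 𝓘(ℝ, E4) ∞ X) :
    ContMDiff I4 (I4.prod 𝓘(ℝ, E4)) ∞
    (fun p : M4 ↦ Bundle.TotalSpace.mk' E4 (E := fun p : M4 ↦ TangentSpace I4 p) p (X p)) := by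
  intro p
  refine (Bundle.contMDiffAt_section p).2 ((hX p).congr_of_eventuallyEq ?_)
  filter_upwards [(isOpen_extChartAt_source (I := I4) p).mem_nhds (mem_extChartAt_source p)]
    with z hz
  exact M4_trivialization p z hz (X z)

/-! ## The pseudo Kerr spacetime -/

/-- The coordinate `r`. -/
def rCoord (p : M4) : ℝ := p.2.1

/-- The coordinate `θ ≥ 0`, where `sinh θ = √(x² + y²)`. -/
def thetaCoord (p : M4) : ℝ := Real.arsinh (Real.sqrt (p.2.2.1 ^ 2 + p.2.2.2 ^ 2))

/-- `sinh² θ`. -/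
def sinhSq (p : M4) : ℝ := p.2.2.1 ^ 2 + p.2.2.2 ^ 2

/-- The Kerr function `Δ`. -/
def kerrDelta (a m r : ℝ) : ℝ := r ^ 2 - 2 * m * r + a ^ 2

/-- The larger zero `r₁` of the Kerr function. -/
def rOne (a m : ℝ) : ℝ := m + Real.sqrt (m ^ 2 - a ^ 2)

/-- `ρ² = r² + a² cosh² θ`. -/
def rhoSq (a : ℝ) (p : M4) : ℝ := rCoord p ^ 2 + a ^ 2 * (1 + sinhSq p)

/-- The covector `dν`. -/
def dNu : E4 →L[ℝ] ℝ := ContinuousLinearMap.fst ℝ ℝ (ℝ × ℝ × ℝ)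

/-- The covector `dr`. -/
def dR : E4 →L[ℝ] ℝ :=
  (ContinuousLinearMap.fst ℝ ℝ (ℝ × ℝ)).comp (ContinuousLinearMap.snd ℝ ℝ (ℝ × ℝ × ℝ))

/-- The covector `dx`. -/
def dX : E4 →L[ℝ] ℝ :=
  (ContinuousLinearMap.fst ℝ ℝ ℝ).comp
    ((ContinuousLinearMap.snd ℝ ℝ (ℝ × ℝ)).comp (ContinuousLinearMap.snd ℝ ℝ (ℝ × ℝ × ℝ)))

/-- The covector `dy`. -/
def dY : E4 →L[ℝ] ℝ :=
  (ContinuousLinearMap.snd ℝ ℝ ℝ).comp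
    ((ContinuousLinearMap.snd ℝ ℝ (ℝ × ℝ)).comp (ContinuousLinearMap.snd ℝ ℝ (ℝ × ℝ × ℝ)))

/-- The covector `x dy - y dx`, which is `sinh² θ dφ`. -/
def sinhSqDPhi (p : M4) : E4 →L[ℝ] ℝ := p.2.2.1 • dY - p.2.2.2 • dX

/-- The covector `x dx + y dy`, which is `sinh θ cosh θ dθ`. -/
def sinhCoshDTheta (p : M4) : E4 →L[ℝ] ℝ := p.2.2.1 • dX + p.2.2.2 • dY

/-- The tensor product of two covectors. -/
def tens (α β : E4 →L[ℝ] ℝ) : E4 →L[ℝ] E4 →L[ℝ] ℝ := α.smulRight β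

@[simp] lemma tens_apply (α β : E4 →L[ℝ] ℝ) (v w : E4) : tens α β v w = α v * β w := rfl

/-- The metric of the hyperbolic plane, `dx² + dy² - (x dx + y dy)² / (1 + x² + y²)`, which is
`dθ² + sinh² θ dφ²`. -/
def hypMetric (p : M4) : E4 →L[ℝ] E4 →L[ℝ] ℝ :=
  tens dX dX + tens dY dY - (1 + sinhSq p)⁻¹ • tens (sinhCoshDTheta p) (sinhCoshDTheta p)

/-- The pseudo Kerr metric on all of `M`. It is the smooth extension over `θ = 0` of
`g_νν dν² - 2 dν dr + 2 g_νφ dν dφ - 2 a sinh² θ dr dφ + ρ² dθ² + g_φφ dφ²`,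
written with `sinh² θ dφ = x dy - y dx` and with
`ρ² dθ² + g_φφ dφ² = ρ² (dθ² + sinh² θ dφ²) - a² (1 + 2 m r / ρ²) (sinh² θ dφ)²`;
see `pseudoKerrMetric_polar`. -/
def pseudoKerrMetric (a m : ℝ) (p : M4) : E4 →L[ℝ] E4 →L[ℝ] ℝ :=
  (1 - 2 * m * rCoord p / rhoSq a p) • tens dNu dNu - (tens dNu dR + tens dR dNu)
    - (2 * m * a * rCoord p / rhoSq a p) • (tens dNu (sinhSqDPhi p) + tens (sinhSqDPhi p) dNu)
    - a • (tens dR (sinhSqDPhi p) + tens (sinhSqDPhi p) dR)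
    + rhoSq a p • hypMetric p
    - (a ^ 2 * (1 + 2 * m * rCoord p / rhoSq a p)) • tens (sinhSqDPhi p) (sinhSqDPhi p)

/-- The coordinate expression of the metric in the coordinates `(ν, r, θ, φ)`. -/
lemma pseudoKerrMetric_polar (a m : ℝ) (ha : 0 < a) (ν : S1) (r θ φ : ℝ) (v w : Fin 4 → ℝ) :
    let p : M4 := (ν, r, Real.sinh θ * Real.cos φ, Real.sinh θ * Real.sin φ)
    let push : (Fin 4 → ℝ) → E4 := fun u ↦ (u 0, u 1,
      u 2 * (Real.cosh θ * Real.cos φ) - u 3 * (Real.sinh θ * Real.sin φ),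
      u 2 * (Real.cosh θ * Real.sin φ) + u 3 * (Real.sinh θ * Real.cos φ))
    let ρ2 : ℝ := r ^ 2 + a ^ 2 * Real.cosh θ ^ 2
    let gνν : ℝ := 1 - 2 * m * r / ρ2
    let gνφ : ℝ := -(2 * m * a * r / ρ2) * Real.sinh θ ^ 2
    let gφφ : ℝ := (r ^ 2 + a ^ 2 - 2 * m * a ^ 2 * r / ρ2 * Real.sinh θ ^ 2) * Real.sinh θ ^ 2
    pseudoKerrMetric a m p (push v) (push w) =
      gνν * (v 0 * w 0) - (v 0 * w 1 + v 1 * w 0) + gνφ * (v 0 * w 3 + v 3 * w 0)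
        - a * Real.sinh θ ^ 2 * (v 1 * w 3 + v 3 * w 1) + ρ2 * (v 2 * w 2) + gφφ * (v 3 * w 3) := by
  intro p push ρ2 gνν gνφ gφφ
  have hs : sinhSq p = Real.sinh θ ^ 2 := by
    simp only [sinhSq, p]
    linear_combination Real.sinh θ ^ 2 * Real.sin_sq_add_cos_sq φ
  have hρ : rhoSq a p = ρ2 := by
    simp only [rhoSq, hs, ρ2, rCoord, p, Real.cosh_sq]; ring
  have hρ0 : ρ2 ≠ 0 := by have := Real.cosh_pos θ; positivity
  have hx : p.2.2.1 = Real.sinh θ * Real.cos φ := rfl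
  have hy : p.2.2.2 = Real.sinh θ * Real.sin φ := rfl
  have e1 : ∀ u, sinhSqDPhi p (push u) = Real.sinh θ ^ 2 * u 3 := by
    intro u
    simp only [sinhSqDPhi, hx, hy, dX, dY, push]
    simp
    linear_combination Real.sinh θ ^ 2 * u 3 * Real.sin_sq_add_cos_sq φ
  have e2 : ∀ u, sinhCoshDTheta p (push u) = Real.sinh θ * Real.cosh θ * u 2 := by
    intro u
    simp only [sinhCoshDTheta, hx, hy, dX, dY, push]
    simp
    linear_combination Real.sinh θ * Real.cosh θ * u 2 * Real.sin_sq_add_cos_sq φ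
  have e3 : hypMetric p (push v) (push w) = v 2 * w 2 + Real.sinh θ ^ 2 * (v 3 * w 3) := by
    have hc : 1 + Real.sinh θ ^ 2 = Real.cosh θ ^ 2 := by rw [Real.cosh_sq]; ring
    have hc0 : Real.cosh θ ≠ 0 := (Real.cosh_pos θ).ne'
    have h : (Real.cosh θ ^ 2)⁻¹ * (Real.sinh θ * Real.cosh θ * v 2 *
        (Real.sinh θ * Real.cosh θ * w 2)) = Real.sinh θ ^ 2 * (v 2 * w 2) := by
      field_simp
    simp only [hypMetric, hs, hc]
    simp [e2, h]
    simp only [dX, dY, push]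
    simp
    linear_combination (Real.cosh θ ^ 2 * (v 2 * w 2) + Real.sinh θ ^ 2 * (v 3 * w 3)) *
      Real.sin_sq_add_cos_sq φ - v 2 * w 2 * hc
  have e4 : ∀ u, dNu (push u) = u 0 := fun u => rfl
  have e5 : ∀ u, dR (push u) = u 1 := fun u => rfl
  have e6 : rCoord p = r := rfl
  simp only [pseudoKerrMetric, hρ, e6]
  simp [e1, e3, e4, e5]
  simp only [gνν, gνφ, gφφ]
  field_simp
  simp only [ρ2, Real.cosh_sq]
  ring

/-- The time orientation: the vector field
`-(1 + Δ / 2) ∂_r - (r² + a²) ∂_ν - a ∂_φ`, with `∂_φ = x ∂_y - y ∂_x`. It is timelike, and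
`-∂_r̄` is future pointing where `r > r₁`; see `future_neg_dRBar`. -/
def pseudoKerrTimeField (a m : ℝ) (p : M4) : E4 :=
  (-(rCoord p ^ 2 + a ^ 2), -(1 + kerrDelta a m (rCoord p) / 2), a * p.2.2.2, -(a * p.2.2.1))

lemma rhoSq_pos {a : ℝ} (ha : 0 < a) (p : M4) : 0 < rhoSq a p := by
  unfold rhoSq sinhSq; positivity

lemma pseudoKerrMetric_apply {a m : ℝ} (ha : 0 < a) (p : M4) (v w : E4) :
    pseudoKerrMetric a m p v w =
      (kerrDelta a m (rCoord p) + a ^ 2 * sinhSq p) / rhoSq a p *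
        ((v.1 + a * sinhSqDPhi p v) * (w.1 + a * sinhSqDPhi p w))
      - (v.1 + a * sinhSqDPhi p v) * w.2.1 - (w.1 + a * sinhSqDPhi p w) * v.2.1
      - a * ((v.1 + a * sinhSqDPhi p v) * sinhSqDPhi p w
        + (w.1 + a * sinhSqDPhi p w) * sinhSqDPhi p v)
      + rhoSq a p * hypMetric p v w := by
  have h := (rhoSq_pos ha p).ne'
  have hc : 1 - 2 * m * rCoord p / rhoSq a p =
      (kerrDelta a m (rCoord p) + a ^ 2 * sinhSq p) / rhoSq a p := by
    field_simp
    simp only [rhoSq, kerrDelta]; ring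
  have hd : 2 * m * rCoord p / rhoSq a p =
      1 - (kerrDelta a m (rCoord p) + a ^ 2 * sinhSq p) / rhoSq a p := by linarith
  have he : 2 * m * a * rCoord p / rhoSq a p = a * (2 * m * rCoord p / rhoSq a p) := by ring
  simp only [pseudoKerrMetric, he, hd]
  simp [dNu, dR]
  ring

lemma pseudoKerr_timeField_apply {a m : ℝ} (ha : 0 < a) (p : M4) (v : E4) :
    pseudoKerrMetric a m p (pseudoKerrTimeField a m p) v =
      (1 - kerrDelta a m (rCoord p) / 2) * (v.1 + a * sinhSqDPhi p v) + rhoSq a p * v.2.1 := by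
  have h := (rhoSq_pos ha p).ne'
  have h1 : 1 + sinhSq p ≠ 0 := by have : 0 ≤ sinhSq p := by { unfold sinhSq; positivity }
                                   positivity
  have e1 : sinhSqDPhi p (pseudoKerrTimeField a m p) = - a * sinhSq p := by
    simp [sinhSqDPhi, pseudoKerrTimeField, sinhSq, dX, dY]; ring
  have e2 : sinhCoshDTheta p (pseudoKerrTimeField a m p) = 0 := by
    simp [sinhCoshDTheta, pseudoKerrTimeField, dX, dY]; ring
  have e3 : hypMetric p (pseudoKerrTimeField a m p) v = - a * sinhSqDPhi p v := by
    simp [hypMetric, e2]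
    simp [sinhSqDPhi, pseudoKerrTimeField, dX, dY]; ring
  have e4 : (pseudoKerrTimeField a m p).1 + a * (- a * sinhSq p) = - rhoSq a p := by
    simp [pseudoKerrTimeField, rhoSq]; ring
  have e5 : (pseudoKerrTimeField a m p).2.1 = -(1 + kerrDelta a m (rCoord p) / 2) := rfl
  rw [pseudoKerrMetric_apply ha, e1, e3, e4, e5]
  field_simp
  ring

lemma pseudoKerrMetric_symm {a m : ℝ} (ha : 0 < a) (p : M4) (v w : E4) :
    pseudoKerrMetric a m p v w = pseudoKerrMetric a m p w v := by
  have : hypMetric p v w = hypMetric p w v := by simp [hypMetric]; ring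
  rw [pseudoKerrMetric_apply ha, pseudoKerrMetric_apply ha, this]
  ring

lemma pseudoKerr_posDef {a m : ℝ} (ha : 0 < a) (p : M4) (v : E4)
    (h0 : pseudoKerrMetric a m p (pseudoKerrTimeField a m p) v = 0) (hv : v ≠ 0) :
    0 < pseudoKerrMetric a m p v v := by
  have hρ := rhoSq_pos ha p
  have hs : 0 < 1 + sinhSq p := by unfold sinhSq; positivity
  rw [pseudoKerr_timeField_apply ha] at h0
  rw [pseudoKerrMetric_apply ha]
  have hh : hypMetric p v v =
      (v.2.2.1 ^ 2 + v.2.2.2 ^ 2 + sinhSqDPhi p v ^ 2) / (1 + sinhSq p) := by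
    simp only [hypMetric, sinhCoshDTheta, sinhSqDPhi, dX, dY]
    simp
    field_simp
    simp only [sinhSq]
    ring
  have hw : sinhSqDPhi p v = p.2.2.1 * v.2.2.2 - p.2.2.2 * v.2.2.1 := by
    simp [sinhSqDPhi, dX, dY]
  rw [hh]
  have hs2 : sinhSq p = p.2.2.1 ^ 2 + p.2.2.2 ^ 2 := rfl
  set w := sinhSqDPhi p v with hwdef
  set ψ := v.1 + a * w with hψ
  set Δ := kerrDelta a m (rCoord p)
  set ρ := rhoSq a p
  set σ := sinhSq p
  have hr : v.2.1 = (Δ / 2 - 1) * ψ / ρ := by field_simp; linarith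
  have key : (Δ + a ^ 2 * σ) / ρ * (ψ * ψ) - ψ * v.2.1 - ψ * v.2.1 - a * (ψ * w + ψ * w)
      + ρ * ((v.2.2.1 ^ 2 + v.2.2.2 ^ 2 + w ^ 2) / (1 + σ)) =
      (2 * ψ ^ 2 + ((a * ψ * p.2.2.2 + ρ * v.2.2.1) ^ 2 + (a * ψ * p.2.2.1 - ρ * v.2.2.2) ^ 2
        + (a * σ * ψ - ρ * w) ^ 2) / (1 + σ)) / ρ := by
    rw [hr]
    field_simp
    rw [hw, hs2]
    ring
  rw [key]
  refine div_pos ?_ hρ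
  by_contra hneg
  have hA : 0 ≤ ((a * ψ * p.2.2.2 + ρ * v.2.2.1) ^ 2 + (a * ψ * p.2.2.1 - ρ * v.2.2.2) ^ 2
        + (a * σ * ψ - ρ * w) ^ 2) / (1 + σ) := by positivity
  have hψ0 : ψ = 0 := by
    by_contra hne
    have : 0 < 2 * ψ ^ 2 := by positivity
    exact hneg (add_pos_of_pos_of_nonneg this hA)
  rw [hψ0] at hneg
  have hB : (ρ * v.2.2.1) ^ 2 + (ρ * v.2.2.2) ^ 2 + (ρ * w) ^ 2 ≤ 0 := by
    have : ((ρ * v.2.2.1) ^ 2 + (ρ * v.2.2.2) ^ 2 + (ρ * w) ^ 2) / (1 + σ) ≤ 0 := by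
      refine le_trans (le_of_eq ?_) (not_lt.1 hneg)
      ring
    rwa [div_le_iff₀ hs, zero_mul] at this
  have hz : ∀ t : ℝ, (ρ * t) ^ 2 ≤ 0 → t = 0 := by
    intro t ht
    have : ρ * t = 0 := pow_eq_zero_iff two_ne_zero |>.1 (le_antisymm ht (sq_nonneg _))
    exact (mul_eq_zero.1 this).resolve_left hρ.ne'
  have h1 : v.2.2.1 = 0 := hz _ (by linarith [sq_nonneg (ρ * v.2.2.2), sq_nonneg (ρ * w)])
  have h2 : v.2.2.2 = 0 := hz _ (by linarith [sq_nonneg (ρ * v.2.2.1), sq_nonneg (ρ * w)])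
  have h3 : w = 0 := hz _ (by linarith [sq_nonneg (ρ * v.2.2.1), sq_nonneg (ρ * v.2.2.2)])
  have h4 : v.1 = 0 := by rw [h3] at hψ; linarith
  have h5 : v.2.1 = 0 := by rw [hr, hψ0]; simp
  exact hv (Prod.ext h4 (Prod.ext h5 (Prod.ext h1 h2)))

lemma pseudoKerr_timeField_timelike {a m : ℝ} (ha : 0 < a) (p : M4) :
    pseudoKerrMetric a m p (pseudoKerrTimeField a m p) (pseudoKerrTimeField a m p) < 0 := by
  have hρ := rhoSq_pos ha p
  have e1 : sinhSqDPhi p (pseudoKerrTimeField a m p) = - a * sinhSq p := by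
    simp [sinhSqDPhi, pseudoKerrTimeField, sinhSq, dX, dY]; ring
  have e4 : (pseudoKerrTimeField a m p).1 + a * (- a * sinhSq p) = - rhoSq a p := by
    simp [pseudoKerrTimeField, rhoSq]; ring
  have e5 : (pseudoKerrTimeField a m p).2.1 = -(1 + kerrDelta a m (rCoord p) / 2) := rfl
  rw [pseudoKerr_timeField_apply ha, e1, e4, e5]
  nlinarith

lemma pseudoKerrMetric_contMDiff {a m : ℝ} (ha : 0 < a) :
    ContMDiff I4 𝓘(ℝ, E4 →L[ℝ] E4 →L[ℝ] ℝ) ∞ (pseudoKerrMetric a m) := by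
  have hsn : ContMDiff I4 𝓘(ℝ, ℝ × ℝ × ℝ) ∞ (fun p : M4 => p.2) := contMDiff_snd
  let ι : ℝ × ℝ × ℝ → M4 := fun q => (0, q)
  have hρ : ∀ q, rhoSq a (ι q) ≠ 0 := fun q => (rhoSq_pos ha _).ne'
  have hs : ∀ q, 1 + sinhSq (ι q) ≠ 0 := fun q => by unfold sinhSq; positivity
  have cs : ContDiff ℝ ∞ (fun q => sinhSq (ι q)) := by
    simp only [sinhSq, ι]; fun_prop
  have cr : ContDiff ℝ ∞ (fun q => rCoord (ι q)) := by
    simp only [rCoord, ι]; fun_prop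
  have cρ : ContDiff ℝ ∞ (fun q => rhoSq a (ι q)) := by
    simp only [rhoSq]; fun_prop
  have cw : ∀ v, ContDiff ℝ ∞ (fun q => sinhSqDPhi (ι q) v) := fun v => by
    simp [sinhSqDPhi, ι]; fun_prop
  have cσ : ∀ v, ContDiff ℝ ∞ (fun q => sinhCoshDTheta (ι q) v) := fun v => by
    simp [sinhCoshDTheta, ι]; fun_prop
  have ch : ∀ v w, ContDiff ℝ ∞ (fun q => hypMetric (ι q) v w) := fun v w => by
    have ci := (contDiff_const (c := (1 : ℝ))).add cs |>.inv hs
    have := ((contDiff_const (c := dX v * dX w + dY v * dY w)).sub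
      (ci.mul ((cσ v).mul (cσ w))))
    simpa [hypMetric] using this
  have hG : ContDiff ℝ ∞ (fun q => pseudoKerrMetric a m (ι q)) := by
    rw [contDiff_clm_apply_iff]
    intro v
    rw [contDiff_clm_apply_iff]
    intro w
    simp only [pseudoKerrMetric_apply ha, kerrDelta]
    have cw1 := cw v
    have cw2 := cw w
    have ch1 := ch v w
    fun_prop (disch := exact fun q => hρ q)
  exact hG.contMDiff.comp hsn

lemma pseudoKerrTimeField_contMDiff (a m : ℝ) :
    ContMDiff I4 𝓘(ℝ, E4) ∞ (pseudoKerrTimeField a m) := by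
  have hsn : ContMDiff I4 𝓘(ℝ, ℝ × ℝ × ℝ) ∞ (fun p : M4 => p.2) := contMDiff_snd
  have hG : ContDiff ℝ ∞ (fun q : ℝ × ℝ × ℝ => pseudoKerrTimeField a m ((0 : S1), q)) := by
    simp only [pseudoKerrTimeField, kerrDelta, rCoord]; fun_prop
  exact hG.contMDiff.comp hsn

/-- The pseudo Kerr spacetime with mass `m` and rotation parameter `a > 0`. -/
def pseudoKerr (a m : ℝ) (ha : 0 < a) : Spacetime I4 M4 where
  dim_eq_four := by simp
  metric := pseudoKerrMetric a m
  metric_symm := pseudoKerrMetric_symm ha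
  metric_smooth := M4_metric_smooth (pseudoKerrMetric_contMDiff ha)
  timeField := pseudoKerrTimeField a m
  timeField_smooth := M4_field_smooth (pseudoKerrTimeField_contMDiff a m)
  timeField_timelike := pseudoKerr_timeField_timelike ha
  posDef_orthogonal := pseudoKerr_posDef ha

/-- The vector field `∂_r̄ = ∂_r + ((r² + a²) / Δ) ∂_ν + (a / Δ) ∂_φ` of the coordinates
`(ν̄, r̄, θ̄, φ̄) = (ν - T(r), r, θ, φ - A(r))`, `T' = (r² + a²) / Δ`, `A' = a / Δ`. -/
def dRBar (a m : ℝ) (p : M4) : E4 :=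
  ((rCoord p ^ 2 + a ^ 2) / kerrDelta a m (rCoord p), 1,
    -(a / kerrDelta a m (rCoord p) * p.2.2.2), a / kerrDelta a m (rCoord p) * p.2.2.1)

/-- The region `R_I`, where `r > r₁`. -/
def regionI (a m : ℝ) : Set M4 := {p | rOne a m < rCoord p}

/-- The time orientation is the one for which `-∂_r̄` is future pointing on `R_I`. -/
lemma future_neg_dRBar {a m : ℝ} (ha : 0 < a) (ham : a < m) {p : M4} (hp : p ∈ regionI a m) :
    (pseudoKerr a m ha).IsFutureTimelike p (-dRBar a m p) := by
  have hρ := rhoSq_pos ha p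
  have hΔ : 0 < kerrDelta a m (rCoord p) := by
    have h1 : 0 ≤ m ^ 2 - a ^ 2 := by nlinarith
    have h2 := Real.sq_sqrt h1
    have h3 : Real.sqrt (m ^ 2 - a ^ 2) < rCoord p - m := by
      have : m + Real.sqrt (m ^ 2 - a ^ 2) < rCoord p := hp
      linarith
    have h4 := Real.sqrt_nonneg (m ^ 2 - a ^ 2)
    unfold kerrDelta
    nlinarith
  have e1 : sinhSqDPhi p (-dRBar a m p) = -(a / kerrDelta a m (rCoord p) * sinhSq p) := by
    simp [sinhSqDPhi, dRBar, sinhSq, dX, dY]; ring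
  have e2 : sinhCoshDTheta p (-dRBar a m p) = 0 := by
    simp [sinhCoshDTheta, dRBar, dX, dY]; ring
  have e3 : hypMetric p (-dRBar a m p) (-dRBar a m p) =
      (a / kerrDelta a m (rCoord p)) ^ 2 * sinhSq p := by
    simp [hypMetric, e2]
    simp [dRBar, sinhSq, dX, dY]; ring
  have e4 : (-dRBar a m p).1 + a * -(a / kerrDelta a m (rCoord p) * sinhSq p) =
      - (rhoSq a p / kerrDelta a m (rCoord p)) := by
    simp [dRBar, rhoSq]; field_simp; ring
  have e5 : (-dRBar a m p).2.1 = -1 := rfl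
  constructor
  · change pseudoKerrMetric a m p (-dRBar a m p) (-dRBar a m p) < 0
    rw [pseudoKerrMetric_apply ha, e1, e3, e4, e5]
    have : (kerrDelta a m (rCoord p) + a ^ 2 * sinhSq p) / rhoSq a p *
        (-(rhoSq a p / kerrDelta a m (rCoord p)) * -(rhoSq a p / kerrDelta a m (rCoord p))) -
        -(rhoSq a p / kerrDelta a m (rCoord p)) * -1 -
        -(rhoSq a p / kerrDelta a m (rCoord p)) * -1 -
        a * (-(rhoSq a p / kerrDelta a m (rCoord p)) *
          -(a / kerrDelta a m (rCoord p) * sinhSq p) +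
        -(rhoSq a p / kerrDelta a m (rCoord p)) * -(a / kerrDelta a m (rCoord p) * sinhSq p)) +
        rhoSq a p * ((a / kerrDelta a m (rCoord p)) ^ 2 * sinhSq p) =
        - (rhoSq a p / kerrDelta a m (rCoord p)) := by
      field_simp
      ring
    rw [this]
    exact neg_neg_of_pos (div_pos hρ hΔ)
  · change pseudoKerrMetric a m p (pseudoKerrTimeField a m p) (-dRBar a m p) < 0
    rw [pseudoKerr_timeField_apply ha, e1, e4, e5]
    have : (1 - kerrDelta a m (rCoord p) / 2) * -(rhoSq a p / kerrDelta a m (rCoord p)) +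
        rhoSq a p * -1 = -(rhoSq a p / kerrDelta a m (rCoord p)) - rhoSq a p / 2 := by
      field_simp; ring
    rw [this]
    have := div_pos hρ hΔ
    linarith

/-- The horizon `H₁`, where `r = r₁`. -/
def horizonOne (a m : ℝ) : Set M4 := {p | rCoord p = rOne a m}

/-- The hypersurface `r = rs`. -/
def levelSet (rs : ℝ) : Set M4 := {p | rCoord p = rs}

/-- The set `C = {r = rs, θ ≤ θ₀}`. -/
def cap (rs θ₀ : ℝ) : Set M4 := {p | rCoord p = rs ∧ thetaCoord p ≤ θ₀}

/-- The curve `s ↦ (ν₀ + s, r₁, o)` on the axis `θ = 0` of the horizon `H₁`. -/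
def horizonCurve (a m : ℝ) (ν₀ : S1) (s : ℝ) : M4 := (ν₀ + (s : S1), rOne a m, 0, 0)

end TimeMachine

end

/-!
All causal information is contained in one identity. Write `σ = sinh² θ`, `ρ² = r² + a² (1 + σ)` and
`ψ = dν + a sinh² θ dφ`. Completing the square in the angular part of the metric gives
(`rhoSq_mul_metric`)
`ρ² g(v, v) = Δ ψ² - 2 ρ² ψ dr + Q / (1 + σ)` with `Q ≥ 0`.

Where `Δ > 0`, in particular on `R_I`, a past pointing causal vector therefore has `dr > 0`. So `r`
strictly increases along past pointing causal curves in `R_I`, and such a curve never leaves `R_I`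
again. This excludes closed causal curves through `R_I` and timelike curves between points of a level
set of `r` in `R_I`. On the axis of the horizon the identity degenerates to `g(∂_ν, ∂_ν) = 0`, so that the
circles there are closed null curves.

For causal vectors `Q / (1 + σ) ≤ 2 ρ² ψ dr - Δ ψ² ≤ (ρ² dr)² / Δ`, and this yields `Δ dθ² ≤ dr²`
(`dtheta_le_of_isPastCausal`). A past pointing causal curve that starts on the axis at some `r > r₁`
hence has `θ < ∫ dr / √Δ` over the interval from `r₁` to `rs` as long as `r ≤ rs`, and this integral is
`ln ((rs - m + √Δ(rs)) / (r₁ - m))`, because `ln (r - m + √Δ)` is a primitive of `1 / √Δ`. Such a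
curve stays over the disc `θ ≤ θ₀`, so it can avoid the cap `C` only if `r < rs` throughout. In that
case all components of the velocity are bounded by a multiple of `dr`
(`exists_bound_of_isPastCausal`), so the coordinates have bounded variation and the curve has an
endpoint (`exists_isEndpoint`). Thus the axis points with `r₁ < r < rs` lie in the future domain of
dependence of `C`, and they converge to points of the null circles as `r → r₁`.
-/

noncomputable section

namespace TimeMachine

open scoped Manifold ContDiff Topology
open Set Filter

/-! ### Causal vectors of the pseudo Kerr metric -/

lemma sinhSqDPhi_apply (p : M4) (v : E4) :
    sinhSqDPhi p v = p.2.2.1 * v.2.2.2 - p.2.2.2 * v.2.2.1 := by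
  simp [sinhSqDPhi, dX, dY]

lemma sinhSq_nonneg (p : M4) : 0 ≤ sinhSq p := by
  unfold sinhSq; positivity

/-- The covector `ψ = dν + a sinh² θ dφ`. -/
def psi (a : ℝ) (p : M4) (v : E4) : ℝ := v.1 + a * sinhSqDPhi p v

/-- `1 + σ` times the squared length, in the hyperbolic plane, of `ρ²` times the velocity relative
to the rotation `(a ψ / ρ²) ∂_φ`, where `σ = sinh² θ`. -/
def transverse (a : ℝ) (p : M4) (v : E4) : ℝ :=
  (a * psi a p v * p.2.2.2 + rhoSq a p * v.2.2.1) ^ 2 +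
    (a * psi a p v * p.2.2.1 - rhoSq a p * v.2.2.2) ^ 2 +
    (a * sinhSq p * psi a p v - rhoSq a p * sinhSqDPhi p v) ^ 2

lemma transverse_nonneg (a : ℝ) (p : M4) (v : E4) : 0 ≤ transverse a p v := by
  unfold transverse; positivity

/-- Completing the square in the angular part. Apart from `-2 ρ² ψ dr`, only nonnegative terms
occur where `Δ ≥ 0`, so that `ψ dr ≥ 0` on causal vectors. -/
lemma rhoSq_mul_metric {a m : ℝ} (ha : 0 < a) (p : M4) (v : E4) :
    rhoSq a p * pseudoKerrMetric a m p v v =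
      kerrDelta a m (rCoord p) * psi a p v ^ 2 - 2 * rhoSq a p * psi a p v * v.2.1 +
        transverse a p v / (1 + sinhSq p) := by
  have hρ := rhoSq_pos ha p
  have hs : 0 < 1 + sinhSq p := by have := sinhSq_nonneg p; positivity
  have hh : hypMetric p v v =
      (v.2.2.1 ^ 2 + v.2.2.2 ^ 2 + sinhSqDPhi p v ^ 2) / (1 + sinhSq p) := by
    simp only [hypMetric, sinhCoshDTheta, sinhSqDPhi, dX, dY]
    simp
    field_simp
    simp only [sinhSq]
    ring
  rw [pseudoKerrMetric_apply ha, hh, transverse, psi]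
  have hw := sinhSqDPhi_apply p v
  have hs2 : sinhSq p = p.2.2.1 ^ 2 + p.2.2.2 ^ 2 := rfl
  field_simp
  rw [hw, hs2]
  ring

/-- A vector annihilated by `ψ`, by `dr` and by the transverse form vanishes. -/
lemma eq_zero_of_transverse_eq_zero {a : ℝ} (ha : 0 < a) {p : M4} {v : E4}
    (hψ : psi a p v = 0) (hr : v.2.1 = 0) (hQ : transverse a p v ≤ 0) : v = 0 := by
  have hρ := rhoSq_pos ha p
  have hz : ∀ t : ℝ, (rhoSq a p * t) ^ 2 ≤ 0 → t = 0 := by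
    intro t ht
    have : rhoSq a p * t = 0 := pow_eq_zero_iff two_ne_zero |>.1 (le_antisymm ht (sq_nonneg _))
    exact (mul_eq_zero.1 this).resolve_left hρ.ne'
  have hB : (rhoSq a p * v.2.2.1) ^ 2 + (rhoSq a p * v.2.2.2) ^ 2 +
      (rhoSq a p * sinhSqDPhi p v) ^ 2 ≤ 0 := by
    refine le_trans (le_of_eq ?_) hQ
    rw [transverse, hψ]
    ring
  have h1 : v.2.2.1 = 0 := hz _ (by
    linarith [sq_nonneg (rhoSq a p * v.2.2.2), sq_nonneg (rhoSq a p * sinhSqDPhi p v)])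
  have h2 : v.2.2.2 = 0 := hz _ (by
    linarith [sq_nonneg (rhoSq a p * v.2.2.1), sq_nonneg (rhoSq a p * sinhSqDPhi p v)])
  have h4 : v.1 = 0 := by
    rw [psi, sinhSqDPhi_apply, h1, h2] at hψ
    linarith
  exact Prod.ext h4 (Prod.ext hr (Prod.ext h1 h2))

lemma kerrDelta_eq (a m r : ℝ) : kerrDelta a m r = (r - m) ^ 2 - (m ^ 2 - a ^ 2) := by
  unfold kerrDelta; ring

lemma rOne_sub_pos {a m : ℝ} (ha : 0 < a) (ham : a < m) : 0 < rOne a m - m := by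
  have : 0 < m ^ 2 - a ^ 2 := by nlinarith
  simpa [rOne] using this

lemma kerrDelta_rOne {a m : ℝ} (ha : 0 < a) (ham : a < m) : kerrDelta a m (rOne a m) = 0 := by
  have h : 0 ≤ m ^ 2 - a ^ 2 := by nlinarith
  rw [kerrDelta_eq, rOne, add_sub_cancel_left, Real.sq_sqrt h, sub_self]

lemma kerrDelta_mono {a m r s : ℝ} (hr : m ≤ r) (hrs : r ≤ s) :
    kerrDelta a m r ≤ kerrDelta a m s := by
  unfold kerrDelta; nlinarith

lemma kerrDelta_pos {a m r : ℝ} (ha : 0 < a) (ham : a < m) (hr : rOne a m < r) :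
    0 < kerrDelta a m r := by
  have h1 := rOne_sub_pos ha ham
  rw [← kerrDelta_rOne ha ham]
  unfold kerrDelta
  nlinarith

section PastCausal

variable {a m : ℝ} (ha : 0 < a) {p : M4} {v : E4}

lemma transverse_le (hv : (pseudoKerr a m ha).IsPastCausal p v) :
    transverse a p v / (1 + sinhSq p) ≤
      2 * rhoSq a p * psi a p v * v.2.1 - kerrDelta a m (rCoord p) * psi a p v ^ 2 := by
  have h1 : pseudoKerrMetric a m p v v ≤ 0 := hv.2.1
  have h2 := rhoSq_mul_metric (m := m) ha p v
  have h3 := mul_nonpos_of_nonneg_of_nonpos (rhoSq_pos ha p).le h1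
  linarith

/-- The function `r` is strictly increasing along past pointing causal curves in `R_I`. -/
lemma dr_pos_of_isPastCausal (hΔ : 0 < kerrDelta a m (rCoord p))
    (hv : (pseudoKerr a m ha).IsPastCausal p v) : 0 < v.2.1 := by
  have hρ := rhoSq_pos ha p
  have hle := transverse_le ha hv
  have hσ : 0 < 1 + sinhSq p := by have := sinhSq_nonneg p; positivity
  have hQ := div_nonneg (transverse_nonneg a p v) hσ.le
  have hT : 0 < (1 - kerrDelta a m (rCoord p) / 2) * psi a p v + rhoSq a p * v.2.1 := by
    rw [psi, ← pseudoKerr_timeField_apply ha]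
    exact hv.2.2
  by_contra! hneg
  have hψ : psi a p v ≤ 0 := by
    by_contra! h
    have := mul_pos hΔ (pow_pos h 2)
    have := mul_nonneg (mul_pos hρ h).le (neg_nonneg.2 hneg)
    nlinarith
  rcases hψ.lt_or_eq with h | h
  · have : kerrDelta a m (rCoord p) * psi a p v ≥ 2 * (rhoSq a p * v.2.1) := by
      by_contra! h'
      nlinarith
    nlinarith
  · rw [h] at hT
    nlinarith

lemma psi_nonneg_of_isPastCausal (hΔ : 0 < kerrDelta a m (rCoord p))
    (hv : (pseudoKerr a m ha).IsPastCausal p v) : 0 ≤ psi a p v := by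
  have hρ := rhoSq_pos ha p
  have hD := dr_pos_of_isPastCausal ha hΔ hv
  have hle := transverse_le ha hv
  have hσ : 0 < 1 + sinhSq p := by have := sinhSq_nonneg p; positivity
  have hQ := div_nonneg (transverse_nonneg a p v) hσ.le
  by_contra! h
  have := mul_pos hΔ (pow_pos (neg_pos.2 h) 2)
  have := mul_pos (mul_pos hρ (neg_pos.2 h)) hD
  nlinarith

lemma psi_le_of_isPastCausal (hΔ : 0 < kerrDelta a m (rCoord p))
    (hv : (pseudoKerr a m ha).IsPastCausal p v) :
    kerrDelta a m (rCoord p) * psi a p v ≤ 2 * rhoSq a p * v.2.1 := by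
  have hρ := rhoSq_pos ha p
  have hD := dr_pos_of_isPastCausal ha hΔ hv
  have hle := transverse_le ha hv
  have hσ : 0 < 1 + sinhSq p := by have := sinhSq_nonneg p; positivity
  have hQ := div_nonneg (transverse_nonneg a p v) hσ.le
  rcases (psi_nonneg_of_isPastCausal ha hΔ hv).eq_or_lt with h | h
  · rw [← h]; simp; positivity
  · refine le_of_mul_le_mul_right ?_ h
    linarith

lemma transverse_le_of_isPastCausal (hΔ : 0 < kerrDelta a m (rCoord p))
    (hv : (pseudoKerr a m ha).IsPastCausal p v) :
    kerrDelta a m (rCoord p) * transverse a p v ≤ (1 + sinhSq p) * (rhoSq a p * v.2.1) ^ 2 := by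
  have hle := transverse_le ha hv
  have hσ : 0 < 1 + sinhSq p := by have := sinhSq_nonneg p; positivity
  have h1 : kerrDelta a m (rCoord p) * (transverse a p v / (1 + sinhSq p)) ≤
      (rhoSq a p * v.2.1) ^ 2 := by
    refine (mul_le_mul_of_nonneg_left hle hΔ.le).trans ?_
    nlinarith [sq_nonneg (rhoSq a p * v.2.1 - kerrDelta a m (rCoord p) * psi a p v)]
  rw [← mul_div_assoc, div_le_iff₀ hσ] at h1
  linarith

/-- The estimate `Δ dθ² ≤ dr²`, multiplied by `(sinh θ cosh θ)²`. -/
lemma dtheta_le_of_isPastCausal (hΔ : 0 < kerrDelta a m (rCoord p))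
    (hv : (pseudoKerr a m ha).IsPastCausal p v) :
    kerrDelta a m (rCoord p) * (p.2.2.1 * v.2.2.1 + p.2.2.2 * v.2.2.2) ^ 2 ≤
      sinhSq p * (1 + sinhSq p) * v.2.1 ^ 2 := by
  have hρ := rhoSq_pos ha p
  have hσ := sinhSq_nonneg p
  have h1 : (rhoSq a p * (p.2.2.1 * v.2.2.1 + p.2.2.2 * v.2.2.2)) ^ 2 ≤
      sinhSq p * transverse a p v := by
    have : sinhSq p * transverse a p v =
        (rhoSq a p * (p.2.2.1 * v.2.2.1 + p.2.2.2 * v.2.2.2)) ^ 2 + (1 + sinhSq p) *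
          (a * sinhSq p * psi a p v - rhoSq a p * sinhSqDPhi p v) ^ 2 := by
      rw [transverse, sinhSqDPhi_apply, sinhSq]
      ring
    rw [this]
    have : 0 ≤ (1 + sinhSq p) *
      (a * sinhSq p * psi a p v - rhoSq a p * sinhSqDPhi p v) ^ 2 := by positivity
    linarith
  have h2 := transverse_le_of_isPastCausal ha hΔ hv
  have h3 : rhoSq a p ^ 2 * (kerrDelta a m (rCoord p) *
      (p.2.2.1 * v.2.2.1 + p.2.2.2 * v.2.2.2) ^ 2) ≤
      rhoSq a p ^ 2 * (sinhSq p * (1 + sinhSq p) * v.2.1 ^ 2) := by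
    have h4 := mul_le_mul_of_nonneg_left h1 hΔ.le
    have h5 := mul_le_mul_of_nonneg_left h2 hσ
    nlinarith
  exact le_of_mul_le_mul_left h3 (by positivity)

end PastCausal

/-- Where `Δ` is bounded below and `r` and `θ` are bounded, `dr` controls all components of past
pointing causal vectors. -/
lemma exists_bound_of_isPastCausal {a m : ℝ} (ha : 0 < a) {Δ₀ : ℝ} (hΔ₀ : 0 < Δ₀) (R S : ℝ) :
    ∃ C, ∀ (p : M4) (v : E4), (pseudoKerr a m ha).IsPastCausal p v →
      Δ₀ ≤ kerrDelta a m (rCoord p) → rhoSq a p ≤ R → sinhSq p ≤ S →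
      |v.1| ≤ C * v.2.1 ∧ |v.2.2.1| ≤ C * v.2.1 ∧ |v.2.2.2| ≤ C * v.2.1 := by
  set K : ℝ := √((1 + S) / Δ₀) + 2 * a * √S / Δ₀ with hK
  have hK0 : 0 ≤ K := by positivity
  set N : ℝ := 2 * R / Δ₀ + a * (√S * K + √S * K) with hN
  refine ⟨max K N, fun p v hv hΔp hR hS => ?_⟩
  have hΔ := hΔ₀.trans_le hΔp
  have hρ := rhoSq_pos ha p
  have hσ := sinhSq_nonneg p
  have hS0 : 0 ≤ S := hσ.trans hS
  have hD := dr_pos_of_isPastCausal ha hΔ hv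
  have hψ0 := psi_nonneg_of_isPastCausal ha hΔ hv
  have hψ := psi_le_of_isPastCausal ha hΔ hv
  have hQ := transverse_le_of_isPastCausal ha hΔ hv
  have hψ1 : psi a p v ≤ 2 * rhoSq a p * v.2.1 / Δ₀ := by
    rw [le_div_iff₀ hΔ₀]
    nlinarith
  have hx : |p.2.2.1| ≤ √S := Real.abs_le_sqrt (by unfold sinhSq at hS; nlinarith)
  have hy : |p.2.2.2| ≤ √S := Real.abs_le_sqrt (by unfold sinhSq at hS; nlinarith)
  have hQ1 : transverse a p v ≤ (√((1 + S) / Δ₀) * (rhoSq a p * v.2.1)) ^ 2 := by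
    rw [mul_pow, Real.sq_sqrt (by positivity), div_mul_eq_mul_div, le_div_iff₀ hΔ₀]
    have h1 := mul_le_mul_of_nonneg_right hΔp (transverse_nonneg a p v)
    have h2 := mul_le_mul_of_nonneg_right hS (sq_nonneg (rhoSq a p * v.2.1))
    linarith
  -- `c` is a coordinate of the base point, `t` a component of `v`
  have comp : ∀ c t : ℝ, |c| ≤ √S →
      (a * psi a p v * c + rhoSq a p * t) ^ 2 ≤ transverse a p v → |t| ≤ K * v.2.1 := by
    intro c t hc ht
    have h1 := abs_le_of_sq_le_sq (ht.trans hQ1) (by positivity)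
    have h2 : |a * psi a p v * c| ≤ a * (2 * rhoSq a p * v.2.1 / Δ₀) * √S := by
      rw [abs_mul, abs_of_nonneg (by positivity : 0 ≤ a * psi a p v)]
      gcongr
    have h3 : |rhoSq a p * t| ≤ rhoSq a p * (K * v.2.1) := by
      have := abs_sub (a * psi a p v * c + rhoSq a p * t) (a * psi a p v * c)
      rw [add_sub_cancel_left] at this
      refine this.trans ((add_le_add h1 h2).trans (le_of_eq ?_))
      rw [hK]
      field_simp
    rw [abs_mul, abs_of_pos hρ] at h3
    exact le_of_mul_le_mul_left h3 hρ
  have hvx : |v.2.2.1| ≤ K * v.2.1 := by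
    refine comp p.2.2.2 v.2.2.1 hy ?_
    unfold transverse
    linarith [sq_nonneg (a * psi a p v * p.2.2.1 - rhoSq a p * v.2.2.2),
      sq_nonneg (a * sinhSq p * psi a p v - rhoSq a p * sinhSqDPhi p v)]
  have hvy : |v.2.2.2| ≤ K * v.2.1 := by
    rw [← abs_neg]
    refine comp p.2.2.1 (-v.2.2.2) hx ?_
    unfold transverse
    have : a * psi a p v * p.2.2.1 + rhoSq a p * -v.2.2.2 =
      a * psi a p v * p.2.2.1 - rhoSq a p * v.2.2.2 := by ring
    rw [this]
    linarith [sq_nonneg (a * psi a p v * p.2.2.2 + rhoSq a p * v.2.2.1),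
      sq_nonneg (a * sinhSq p * psi a p v - rhoSq a p * sinhSqDPhi p v)]
  have hv1 : |v.1| ≤ N * v.2.1 := by
    have h1 : v.1 = psi a p v - a * sinhSqDPhi p v := by unfold psi; ring
    have h2 : |sinhSqDPhi p v| ≤ √S * (K * v.2.1) + √S * (K * v.2.1) := by
      rw [sinhSqDPhi_apply]
      refine (abs_sub _ _).trans ?_
      rw [abs_mul, abs_mul]
      gcongr
    have h3 : psi a p v ≤ 2 * R * v.2.1 / Δ₀ := hψ1.trans (by gcongr)
    rw [h1]
    refine (abs_sub _ _).trans ?_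
    rw [abs_mul, abs_of_pos ha, abs_of_nonneg hψ0]
    refine (add_le_add h3 (mul_le_mul_of_nonneg_left h2 ha.le)).trans (le_of_eq ?_)
    rw [hN]
    ring
  have hm1 := mul_le_mul_of_nonneg_right (le_max_left K N) hD.le
  have hm2 := mul_le_mul_of_nonneg_right (le_max_right K N) hD.le
  exact ⟨hv1.trans hm2, hvx.trans hm1, hvy.trans hm1⟩

/-! ### Monotonicity from one-sided derivatives -/

lemma le_of_right_deriv_nonneg {f f' : ℝ → ℝ} {u v : ℝ} (huv : u ≤ v)
    (hf : ContinuousOn f (Icc u v)) (hf' : ∀ x ∈ Ico u v, HasDerivWithinAt f (f' x) (Ici x) x)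
    (h0 : ∀ x ∈ Ico u v, 0 ≤ f' x) : f u ≤ f v :=
  image_le_of_deriv_right_le_deriv_boundary (f := fun _ => f u) (f' := fun _ => 0)
    continuousOn_const (fun x _ => hasDerivWithinAt_const x (Ici x) (f u)) le_rfl hf hf' h0
    (right_mem_Icc.2 huv)

/-- If the right derivative of `f` is positive wherever `f > c`, then `f` cannot drop below a value
`f u > c` that it has attained. -/
lemma ge_of_right_deriv_pos_of_lt {f f' : ℝ → ℝ} {u v c : ℝ}
    (hf : ContinuousOn f (Icc u v)) (hf' : ∀ x ∈ Ico u v, HasDerivWithinAt f (f' x) (Ici x) x)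
    (h0 : ∀ x ∈ Ico u v, c < f x → 0 < f' x) (hu : c < f u) : ∀ x ∈ Icc u v, f u ≤ f x :=
  image_le_of_deriv_right_lt_deriv_boundary' (f := fun _ => f u) (f' := fun _ => 0)
    continuousOn_const (fun x _ => hasDerivWithinAt_const x (Ici x) (f u)) le_rfl hf hf'
    fun x hx h => h0 x hx (h ▸ hu)

lemma lt_of_right_deriv_pos_of_lt {f f' : ℝ → ℝ} {u v c : ℝ} (huv : u < v)
    (hf : ContinuousOn f (Icc u v)) (hf' : ∀ x ∈ Ico u v, HasDerivWithinAt f (f' x) (Ici x) x)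
    (h0 : ∀ x ∈ Ico u v, c < f x → 0 < f' x) (hu : c < f u) : f u < f v := by
  have hge := ge_of_right_deriv_pos_of_lt hf hf' h0 hu
  refine lt_of_le_of_ne (hge v (right_mem_Icc.2 huv.le)) fun heq => ?_
  have hconst : ∀ x ∈ Icc u v, f x = f u := by
    intro x hx
    refine le_antisymm ?_ (hge x hx)
    rw [heq]
    have hs : Icc x v ⊆ Icc u v := Icc_subset_Icc_left hx.1
    refine le_of_right_deriv_nonneg hx.2 (hf.mono hs)
      (fun y hy => hf' y ⟨hx.1.trans hy.1, hy.2⟩) fun y hy => ?_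
    have hy' : y ∈ Ico u v := ⟨hx.1.trans hy.1, hy.2⟩
    exact (h0 y hy' (hu.trans_le (hge y (Ico_subset_Icc_self hy')))).le
  have hu' : u ∈ Ico u v := left_mem_Ico.2 huv
  have h1 : HasDerivWithinAt f 0 (Ici u) u := by
    refine (hasDerivWithinAt_const u (Ici u) (f u)).congr_of_eventuallyEq ?_ rfl
    filter_upwards [Icc_mem_nhdsGE huv] with x hx using hconst x hx
  have h2 := (uniqueDiffOn_Ici u u self_mem_Ici).eq_deriv _ (hf' u hu') h1
  exact (h0 u hu' hu).ne' h2

/-- The time reversed form of `lt_of_right_deriv_pos_of_lt`. -/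
lemma lt_of_left_deriv_neg_of_lt {f f' : ℝ → ℝ} {u v c : ℝ} (huv : u < v)
    (hf : ContinuousOn f (Icc u v)) (hf' : ∀ x ∈ Ioc u v, HasDerivWithinAt f (f' x) (Iic x) x)
    (h0 : ∀ x ∈ Ioc u v, c < f x → f' x < 0) (hv : c < f v) : f v < f u := by
  have hm : ∀ x ∈ Ico (-v) (-u), -x ∈ Ioc u v := fun x hx => by
    constructor <;> linarith [hx.1, hx.2]
  have h := lt_of_right_deriv_pos_of_lt (f := fun x => f (-x)) (f' := fun x => -f' (-x))
    (u := -v) (v := -u) (c := c) (by linarith) ?_ ?_ ?_ (by simpa using hv)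
  · simpa using h
  · exact hf.comp continuousOn_neg fun x hx => by constructor <;> linarith [hx.1, hx.2]
  · intro x hx
    have h1 := (hf' (-x) (hm x hx)).scomp x (hasDerivWithinAt_neg x (Ici x))
      (fun y hy => by simpa using hy)
    simpa [Function.comp_def] using h1
  · intro x hx hc
    have := h0 (-x) (hm x hx) hc
    linarith

/-! ### One-sided derivatives along piecewise smooth curves -/

section Curves

variable {E : Type*} [NormedAddCommGroup E] [NormedSpace ℝ E]
  {H : Type*} [TopologicalSpace H] {I : ModelWithCorners ℝ E H}
  {M : Type*} [TopologicalSpace M] [ChartedSpace H M] {α : ℝ → M} {J : Set ℝ}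

lemma IsPiecewiseSmoothOn.continuousOn (h : IsPiecewiseSmoothOn I α J) : ContinuousOn α J := by
  intro t ht
  obtain ⟨ε, hε, h1, h2⟩ := h t ht
  have c1 := h1.continuousOn t ⟨ht, left_mem_Icc.2 (by linarith)⟩
  have c2 := h2.continuousOn t ⟨ht, right_mem_Icc.2 (by linarith)⟩
  refine (c1.union c2).mono_of_mem_nhdsWithin ?_
  rw [← inter_union_distrib_left]
  refine inter_mem self_mem_nhdsWithin (mem_nhdsWithin_of_mem_nhds ?_)
  rw [union_comm, Icc_union_Icc_eq_Icc (by linarith) (by linarith)]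
  exact Icc_mem_nhds (by linarith) (by linarith)

lemma IsPiecewiseSmoothOn.hasMFDerivWithinAt_right (h : IsPiecewiseSmoothOn I α J)
    (hJ : J.OrdConnected) {t u : ℝ} (ht : t ∈ J) (hu : u ∈ J) (htu : t < u) :
    HasMFDerivWithinAt 𝓘(ℝ, ℝ) I α (Ici t) t (mfderivWithin 𝓘(ℝ, ℝ) I α (Ici t) t) := by
  obtain ⟨ε, hε, h1, -⟩ := h t ht
  refine MDifferentiableWithinAt.hasMFDerivWithinAt ?_
  refine ((h1 t ⟨ht, left_mem_Icc.2 (by linarith)⟩).mdifferentiableWithinAt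
    (by simp)).mono_of_mem_nhdsWithin ?_
  refine inter_mem ?_ (Icc_mem_nhdsGE (by linarith))
  exact mem_of_superset (Icc_mem_nhdsGE htu) (hJ.out ht hu)

lemma IsPiecewiseSmoothOn.hasMFDerivWithinAt_left (h : IsPiecewiseSmoothOn I α J)
    (hJ : J.OrdConnected) {t u : ℝ} (ht : t ∈ J) (hu : u ∈ J) (hut : u < t) :
    HasMFDerivWithinAt 𝓘(ℝ, ℝ) I α (Iic t) t (mfderivWithin 𝓘(ℝ, ℝ) I α (Iic t) t) := by
  obtain ⟨ε, hε, -, h1⟩ := h t ht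
  refine MDifferentiableWithinAt.hasMFDerivWithinAt ?_
  refine ((h1 t ⟨ht, right_mem_Icc.2 (by linarith)⟩).mdifferentiableWithinAt
    (by simp)).mono_of_mem_nhdsWithin ?_
  refine inter_mem ?_ (Icc_mem_nhdsLE (by linarith))
  exact mem_of_superset (Icc_mem_nhdsLE hut) (hJ.out hu ht)

end Curves

/-! ### Coordinates along curves in `S¹ × ℝ³` -/

/-- The derivative of `α.2` is the second component of the velocity, because the charts of `M4` are
products of charts of the circle with the identity. -/
lemma hasDerivWithinAt_snd {α : ℝ → M4} {s : Set ℝ} {t : ℝ} {L : ℝ →L[ℝ] E4}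
    (h : HasMFDerivWithinAt 𝓘(ℝ, ℝ) I4 α s t L) :
    HasDerivWithinAt (fun t => (α t).2) (L 1).2 s t := by
  have h1 := (hasMFDerivAt_snd (I := 𝓘(ℝ, ℝ)) (I' := 𝓘(ℝ, ℝ × ℝ × ℝ)) (α t)).comp_hasMFDerivWithinAt
    t h
  have h2 : HasFDerivWithinAt (fun t => (α t).2)
      ((ContinuousLinearMap.snd ℝ ℝ (ℝ × ℝ × ℝ)).comp L) s t :=
    hasMFDerivWithinAt_iff_hasFDerivWithinAt.1 h1
  exact h2.hasDerivWithinAt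

/-- The chart of the circle at `x` is, as a function of the angle, a shift by a multiple of `2π`
near `x`. -/
lemma S1_chart_coe (x : ℝ) : ∃ c : ℝ, ((c : ℝ) : S1) = 0 ∧
    ∀ᶠ y in 𝓝 x, chartAt ℝ ((x : ℝ) : S1) ((y : ℝ) : S1) = y + c := by
  set e := chartAt ℝ ((x : ℝ) : S1) with he
  have hs := mem_chart_source ℝ ((x : ℝ) : S1)
  have hc : ((e x : ℝ) : S1) = x := by
    have := e.left_inv hs
    rwa [S1_chart_symm (chart_mem_atlas ℝ _)] at this
  refine ⟨e x - x, by rw [AddCircle.coe_sub, hc, sub_self], ?_⟩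
  have h1 : ∀ᶠ y in 𝓝 x, y + (e x - x) ∈ e.target := by
    have hcont : ContinuousAt (fun y : ℝ => y + (e x - x)) x := by fun_prop
    refine hcont.eventually (e.open_target.mem_nhds ?_)
    simpa using e.map_source hs
  filter_upwards [h1] with y hy
  have h2 := e.right_inv hy
  rw [S1_chart_symm (chart_mem_atlas ℝ _)] at h2
  have h3 : ((y + (e x - x) : ℝ) : S1) = y := by
    rw [AddCircle.coe_add, AddCircle.coe_sub, hc, sub_self, add_zero]
  rwa [← h3]

/-- A function on the circle has the derivative of the corresponding `2π`-periodic function. -/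
lemma hasMFDerivAt_of_periodic {F : S1 → ℝ} {f : ℝ → ℝ} (hF : ∀ x : ℝ, F (x : S1) = f x)
    {x f' : ℝ} (hf : HasDerivAt f f' x) :
    HasMFDerivAt 𝓘(ℝ, ℝ) 𝓘(ℝ, ℝ) F (x : S1) (ContinuousLinearMap.toSpanSingleton ℝ f') := by
  obtain ⟨c, hc0, hc⟩ := S1_chart_coe x
  have hper : ∀ y, f (y - c) = f y := fun y => by
    rw [← hF, ← hF, AddCircle.coe_sub, hc0, sub_zero]
  have hx := hc.self_of_nhds
  have hfx : HasDerivAt f f' (chartAt ℝ ((x : ℝ) : S1) ((x : ℝ) : S1)) := by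
    rw [hx]
    have h1 : HasDerivAt (fun y => f (y - c)) f' (x + c) :=
      HasDerivAt.comp_sub_const (x + c) c (by simpa using hf)
    simpa only [hper] using h1
  have hsymm : F ∘ (chartAt ℝ ((x : ℝ) : S1)).symm = f := by
    ext y
    rw [Function.comp_apply, S1_chart_symm (chart_mem_atlas ℝ _), hF]
  refine ⟨?_, ?_⟩
  · have h1 : F =ᶠ[𝓝 ((x : ℝ) : S1)] f ∘ chartAt ℝ ((x : ℝ) : S1) := by
      filter_upwards [(chartAt ℝ ((x : ℝ) : S1)).open_source.mem_nhds
        (mem_chart_source ℝ ((x : ℝ) : S1))] with z hz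
      rw [← hsymm, Function.comp_apply, Function.comp_apply,
        (chartAt ℝ ((x : ℝ) : S1)).left_inv hz]
    refine ContinuousAt.congr ?_ h1.symm
    exact ContinuousAt.comp hfx.continuousAt
      ((chartAt ℝ ((x : ℝ) : S1)).continuousAt (mem_chart_source ℝ _))
  · have h2 : writtenInExtChartAt 𝓘(ℝ, ℝ) 𝓘(ℝ, ℝ) ((x : ℝ) : S1) F = f := by
      rw [← hsymm]
      rfl
    rw [h2]
    exact hfx.hasFDerivAt.hasFDerivWithinAt

/-- The derivative along a curve of a function of the coordinate `ν`, given as a periodic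
function. -/
lemma hasDerivWithinAt_comp_fst {F : S1 → ℝ} {f f' : ℝ → ℝ} (hF : ∀ x : ℝ, F (x : S1) = f x)
    (hf : ∀ x, HasDerivAt f (f' x) x) {α : ℝ → M4} {s : Set ℝ} {t : ℝ} {L : ℝ →L[ℝ] E4}
    (h : HasMFDerivWithinAt 𝓘(ℝ, ℝ) I4 α s t L) {x : ℝ} (hx : (x : S1) = (α t).1) :
    HasDerivWithinAt (fun t => F (α t).1) (f' x * (L 1).1) s t := by
  have h1 := (hasMFDerivAt_fst (I := 𝓘(ℝ, ℝ)) (I' := 𝓘(ℝ, ℝ × ℝ × ℝ)) (α t)).comp_hasMFDerivWithinAt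
    t h
  have h2 := hasMFDerivAt_of_periodic hF (hf x)
  rw [hx] at h2
  have h3 : HasFDerivWithinAt (fun t => F (α t).1)
      ((ContinuousLinearMap.toSpanSingleton ℝ (f' x)).comp
        ((ContinuousLinearMap.fst ℝ ℝ (ℝ × ℝ × ℝ)).comp L)) s t :=
    hasMFDerivWithinAt_iff_hasFDerivWithinAt.1 (HasMFDerivAt.comp_hasMFDerivWithinAt t h2 h1)
  have h4 := h3.hasDerivWithinAt
  simpa [mul_comm] using h4

lemma hasMFDerivAt_coe (x : ℝ) :
    HasMFDerivAt 𝓘(ℝ, ℝ) 𝓘(ℝ, ℝ) (fun y : ℝ => (y : S1)) x (ContinuousLinearMap.id ℝ ℝ) := by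
  obtain ⟨c, -, hc⟩ := S1_chart_coe x
  refine ⟨(AddCircle.continuous_mk' _).continuousAt, ?_⟩
  simp only [mfld_simps]
  have : HasFDerivAt (fun y : ℝ => y + c) (ContinuousLinearMap.id ℝ ℝ) x :=
    (hasFDerivAt_id x).add_const c
  exact (this.congr_of_eventuallyEq hc).hasFDerivWithinAt

lemma contMDiff_coe : ContMDiff 𝓘(ℝ, ℝ) 𝓘(ℝ, ℝ) ∞ (fun y : ℝ => (y : S1)) := by
  intro x
  obtain ⟨c, -, hc⟩ := S1_chart_coe x
  rw [contMDiffAt_iff]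
  refine ⟨(AddCircle.continuous_mk' _).continuousAt, ?_⟩
  simp only [mfld_simps]
  have : ContDiffAt ℝ ∞ (fun y : ℝ => y + c) x := by fun_prop
  exact (this.congr_of_eventuallyEq hc).contDiffWithinAt

/-! ### Causality in `R_I` -/

lemma continuous_rCoord : Continuous rCoord := by unfold rCoord; fun_prop

lemma hasDerivWithinAt_rCoord {α : ℝ → M4} {s : Set ℝ} {t : ℝ} {L : ℝ →L[ℝ] E4}
    (h : HasMFDerivWithinAt 𝓘(ℝ, ℝ) I4 α s t L) :
    HasDerivWithinAt (fun t => rCoord (α t)) (L 1).2.1 s t :=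
  (ContinuousLinearMap.fst ℝ ℝ (ℝ × ℝ)).hasFDerivAt.comp_hasDerivWithinAt t
    (hasDerivWithinAt_snd h)

lemma dr_neg_of_isFutureCausal {a m : ℝ} (ha : 0 < a) {p : M4} {v : E4}
    (hΔ : 0 < kerrDelta a m (rCoord p)) (hv : (pseudoKerr a m ha).IsFutureCausal p v) :
    v.2.1 < 0 := by
  have h1 : (pseudoKerr a m ha).IsPastCausal p (-v) := by
    obtain ⟨h0, h1, h2⟩ := hv
    change pseudoKerrMetric a m p v v ≤ 0 at h1
    change pseudoKerrMetric a m p (pseudoKerrTimeField a m p) v < 0 at h2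
    refine ⟨neg_ne_zero.2 h0, ?_, ?_⟩
    · change pseudoKerrMetric a m p (-v) (-v) ≤ 0
      simpa using h1
    · change 0 < pseudoKerrMetric a m p (pseudoKerrTimeField a m p) (-v)
      simpa using h2
  have h2 : 0 < (-v).2.1 := dr_pos_of_isPastCausal ha hΔ h1
  simpa using h2

section

variable {a m : ℝ} (ha : 0 < a) {α : ℝ → M4} {J : Set ℝ}

lemma rCoord_lt_of_past (ham : a < m) (hJ : J.OrdConnected)
    (hα : IsCurveOfType (pseudoKerr a m ha).IsPastCausal α J) {u v : ℝ}
    (hu : u ∈ J) (hv : v ∈ J) (huv : u < v) (h0 : α u ∈ regionI a m) :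
    rCoord (α u) < rCoord (α v) := by
  have hsub := hJ.out hu hv
  refine lt_of_right_deriv_pos_of_lt (f := fun t => rCoord (α t))
    (f' := fun t => (velRight I4 α t : E4).2.1) (c := rOne a m) huv
    (continuous_rCoord.comp_continuousOn (hα.1.continuousOn.mono hsub)) ?_ ?_ h0
  · intro x hx
    exact hasDerivWithinAt_rCoord
      (hα.1.hasMFDerivWithinAt_right hJ (hsub (Ico_subset_Icc_self hx)) hv hx.2)
  · intro x hx hc
    exact dr_pos_of_isPastCausal ha (kerrDelta_pos ha ham hc)
      ((hα.2 x (hsub (Ico_subset_Icc_self hx))).1 ⟨v, hv, hx.2⟩)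

lemma rCoord_lt_of_future (ham : a < m) (hJ : J.OrdConnected)
    (hα : IsCurveOfType (pseudoKerr a m ha).IsFutureCausal α J) {u v : ℝ}
    (hu : u ∈ J) (hv : v ∈ J) (huv : u < v) (h0 : α v ∈ regionI a m) :
    rCoord (α v) < rCoord (α u) := by
  have hsub := hJ.out hu hv
  refine lt_of_left_deriv_neg_of_lt (f := fun t => rCoord (α t))
    (f' := fun t => (velLeft I4 α t : E4).2.1) (c := rOne a m) huv
    (continuous_rCoord.comp_continuousOn (hα.1.continuousOn.mono hsub)) ?_ ?_ h0
  · intro x hx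
    exact hasDerivWithinAt_rCoord
      (hα.1.hasMFDerivWithinAt_left hJ (hsub (Ioc_subset_Icc_self hx)) hu hx.1)
  · intro x hx hc
    exact dr_neg_of_isFutureCausal ha (kerrDelta_pos ha ham hc)
      ((hα.2 x (hsub (Ioc_subset_Icc_self hx))).2 ⟨u, hu, hx.1⟩)

end

lemma isOpen_regionI (a m : ℝ) : IsOpen (regionI a m) :=
  isOpen_lt continuous_const continuous_rCoord

lemma causalityHoldsOn_regionI {a m : ℝ} (ha : 0 < a) (ham : a < m) :
    (pseudoKerr a m ha).CausalityHoldsOn (regionI a m) := by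
  refine eq_empty_iff_forall_notMem.2 ?_
  rintro p ⟨⟨α, s, t, hst, hclosed, hα, u, hu, rfl⟩, hp⟩
  have hs : s ∈ Icc s t := left_mem_Icc.2 hst.le
  have ht : t ∈ Icc s t := right_mem_Icc.2 hst.le
  rcases hα with hα | hα
  · have hlt := fun {x y} => rCoord_lt_of_future (u := x) (v := y) ha ham ordConnected_Icc hα
    have hs' : α s ∈ regionI a m := by
      rcases hu.1.eq_or_lt with h | h
      · rwa [h]
      · exact lt_trans hp (hlt hs hu h hp)
    exact absurd (hlt hs ht hst (hclosed ▸ hs')) (by rw [hclosed]; exact lt_irrefl _)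
  · have hlt := fun {x y} => rCoord_lt_of_past (u := x) (v := y) ha ham ordConnected_Icc hα
    have ht' : α t ∈ regionI a m := by
      rcases hu.2.eq_or_lt with h | h
      · rwa [← h]
      · exact lt_trans hp (hlt hu ht h hp)
    exact absurd (hlt hs ht hst (hclosed ▸ ht')) (by rw [hclosed]; exact lt_irrefl _)

lemma isAchronal_cap {a m : ℝ} (ha : 0 < a) (ham : a < m) {rs : ℝ} (hrs : rOne a m < rs)
    (θ₀ : ℝ) : (pseudoKerr a m ha).IsAchronal (cap rs θ₀) := by
  rintro p hp q hq ⟨α, s, t, hst, rfl, rfl, hα⟩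
  have hcausal : ∀ x (v : TangentSpace I4 x), (pseudoKerr a m ha).IsFutureTimelike x v →
      (pseudoKerr a m ha).IsFutureCausal x v := by
    rintro x v ⟨h1, h2⟩
    refine ⟨?_, h1.le, h2⟩
    rintro rfl
    simp at h1
  have hα' : IsCurveOfType (pseudoKerr a m ha).IsFutureCausal α (Icc s t) :=
    ⟨hα.1, fun x hx => ⟨fun h => hcausal _ _ ((hα.2 x hx).1 h),
      fun h => hcausal _ _ ((hα.2 x hx).2 h)⟩⟩
  have h := rCoord_lt_of_future ha ham ordConnected_Icc hα' (left_mem_Icc.2 hst.le)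
    (right_mem_Icc.2 hst.le) hst (show rOne a m < rCoord (α t) by rw [hq.1]; exact hrs)
  rw [hp.1, hq.1] at h
  exact lt_irrefl _ h

/-! ### Level sets and caps -/

lemma levelSet_subset_regionI {a m rs : ℝ} (hrs : rOne a m < rs) :
    levelSet rs ⊆ regionI a m := fun p hp => by
  change rOne a m < rCoord p
  rw [show rCoord p = rs from hp]
  exact hrs

lemma isSpacelikeHypersurface_levelSet {a m : ℝ} (ha : 0 < a) (ham : a < m) {rs : ℝ}
    (hrs : rOne a m < rs) : (pseudoKerr a m ha).IsSpacelikeHypersurface (levelSet rs) := by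
  intro p _
  have hsm : ContMDiff I4 𝓘(ℝ, ℝ) ∞ (fun q : M4 => rCoord q - rs) := by
    have h1 : ContMDiff I4 𝓘(ℝ, ℝ × ℝ × ℝ) ∞ (fun p : M4 => p.2) := contMDiff_snd
    have h2 : ContDiff ℝ ∞ (fun q : ℝ × ℝ × ℝ => q.1 - rs) := by fun_prop
    exact h2.contMDiff.comp h1
  have hd : ∀ (q : M4) (v : E4), mfderiv I4 𝓘(ℝ, ℝ) (fun q : M4 => rCoord q - rs) q v = v.2.1 := by
    intro q v
    have h1 := hasMFDerivAt_snd (I := 𝓘(ℝ, ℝ)) (I' := 𝓘(ℝ, ℝ × ℝ × ℝ)) q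
    have h2 : HasFDerivAt (fun z : ℝ × ℝ × ℝ => z.1 - rs) (ContinuousLinearMap.fst ℝ ℝ (ℝ × ℝ)) q.2 :=
      (ContinuousLinearMap.fst ℝ ℝ (ℝ × ℝ)).hasFDerivAt.sub_const rs
    have h3 := HasMFDerivAt.comp q h2.hasMFDerivAt h1
    exact DFunLike.congr_fun h3.mfderiv v
  refine ⟨univ, isOpen_univ, mem_univ _, fun q => rCoord q - rs, hsm.contMDiffOn, ?_, ?_⟩
  · ext q
    simp [levelSet, sub_eq_zero]
  · rintro q ⟨hq, -⟩
    refine ⟨fun h => ?_, fun v hv h => ?_⟩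
    · have h1 := hd q (0, 1, 0, 0)
      rw [h] at h1
      exact zero_ne_one (α := ℝ) h1
    · replace h : (v : E4).2.1 = 0 := (hd q v).symm.trans h
      have hΔ := kerrDelta_pos ha ham (levelSet_subset_regionI hrs hq)
      have hρ := rhoSq_pos ha q
      have hσ : 0 < 1 + sinhSq q := by have := sinhSq_nonneg q; positivity
      have key := rhoSq_mul_metric (m := m) ha q v
      rw [h, mul_zero, sub_zero] at key
      change 0 < pseudoKerrMetric a m q v v
      refine pos_of_mul_pos_right ?_ hρ.le
      rw [key]
      have hQ := transverse_nonneg a q v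
      by_contra! hle
      have h1 : 0 ≤ kerrDelta a m (rCoord q) * psi a q v ^ 2 := by positivity
      have h2 : 0 ≤ transverse a q v / (1 + sinhSq q) := by positivity
      have h3 : transverse a q v ≤ 0 := by
        have : transverse a q v / (1 + sinhSq q) ≤ 0 := by linarith
        rwa [div_le_iff₀ hσ, zero_mul] at this
      have h4 : psi a q v = 0 := by
        have : kerrDelta a m (rCoord q) * psi a q v ^ 2 = 0 := by linarith
        simpa [hΔ.ne'] using this
      exact hv (eq_zero_of_transverse_eq_zero ha h4 h h3)

lemma thetaCoord_le_iff {θ₀ : ℝ} (p : M4) :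
    thetaCoord p ≤ θ₀ ↔ √(sinhSq p) ≤ Real.sinh θ₀ := by
  rw [thetaCoord, ← Real.sinh_le_sinh, Real.sinh_arsinh, sinhSq]

lemma isCompact_cap (rs θ₀ : ℝ) : IsCompact (cap rs θ₀) := by
  set b := Real.sinh θ₀
  have hK : IsCompact ((univ : Set S1) ×ˢ ({rs} : Set ℝ) ×ˢ Icc (-b) b ×ˢ Icc (-b) b) := by
    have : Fact (0 < 2 * Real.pi) := ⟨Real.two_pi_pos⟩
    exact isCompact_univ.prod (isCompact_singleton.prod (isCompact_Icc.prod isCompact_Icc))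
  refine hK.of_isClosed_subset ?_ ?_
  · have hθ : Continuous thetaCoord := by
      unfold thetaCoord
      exact Real.continuous_arsinh.comp (by fun_prop)
    exact (isClosed_eq continuous_rCoord continuous_const).inter
      (isClosed_le hθ continuous_const)
  · rintro p ⟨hr, hθ⟩
    rw [thetaCoord_le_iff] at hθ
    have hx : |p.2.2.1| ≤ √(sinhSq p) := Real.abs_le_sqrt (by unfold sinhSq; nlinarith)
    have hy : |p.2.2.2| ≤ √(sinhSq p) := Real.abs_le_sqrt (by unfold sinhSq; nlinarith)
    exact ⟨mem_univ _, hr, abs_le.1 (hx.trans hθ), abs_le.1 (hy.trans hθ)⟩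

/-! ### The closed null curves on the horizon -/

lemma horizonCurve_contMDiff (a m : ℝ) (ν₀ : S1) :
    ContMDiff 𝓘(ℝ, ℝ) I4 ∞ (horizonCurve a m ν₀) := by
  obtain ⟨x₀, rfl⟩ := QuotientAddGroup.mk_surjective ν₀
  have h1 : ContMDiff 𝓘(ℝ, ℝ) 𝓘(ℝ, ℝ) ∞ (fun s : ℝ => ((x₀ + s : ℝ) : S1)) :=
    contMDiff_coe.comp (contDiff_const.add contDiff_id).contMDiff
  exact h1.prodMk contMDiff_const

lemma horizonCurve_hasMFDerivAt (a m : ℝ) (ν₀ : S1) (s : ℝ) :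
    HasMFDerivAt 𝓘(ℝ, ℝ) I4 (horizonCurve a m ν₀) s
      ((ContinuousLinearMap.id ℝ ℝ).prod (0 : ℝ →L[ℝ] ℝ × ℝ × ℝ)) := by
  obtain ⟨x₀, rfl⟩ := QuotientAddGroup.mk_surjective ν₀
  have h0 : HasFDerivAt (fun s : ℝ => x₀ + s) (ContinuousLinearMap.id ℝ ℝ) s :=
    (hasFDerivAt_id s).const_add x₀
  have h1 := HasMFDerivAt.comp s (hasMFDerivAt_coe (x₀ + s)) h0.hasMFDerivAt
  exact h1.prodMk (hasMFDerivAt_const (I := 𝓘(ℝ, ℝ)) (I' := 𝓘(ℝ, ℝ × ℝ × ℝ))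
    ((rOne a m, 0, 0) : ℝ × ℝ × ℝ) s)

lemma isCurveOfType_horizonCurve {a m : ℝ} {P : ∀ p : M4, TangentSpace I4 p → Prop} (ν₀ : S1)
    (hP : ∀ s, P (horizonCurve a m ν₀ s) ((1, 0, 0, 0) : E4)) (J : Set ℝ) :
    IsCurveOfType P (horizonCurve a m ν₀) J := by
  have hsm := horizonCurve_contMDiff a m ν₀
  refine ⟨fun t _ => ⟨1, one_pos, hsm.contMDiffOn, hsm.contMDiffOn⟩, fun t _ => ?_⟩
  have hd := horizonCurve_hasMFDerivAt a m ν₀ t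
  have h1 : velRight I4 (horizonCurve a m ν₀) t = ((1, 0, 0, 0) : E4) := by
    have := hd.hasMFDerivWithinAt.mfderivWithin (s := Ici t)
      (uniqueDiffOn_Ici t t self_mem_Ici).uniqueMDiffWithinAt
    exact DFunLike.congr_fun this (1 : ℝ)
  have h2 : velLeft I4 (horizonCurve a m ν₀) t = ((1, 0, 0, 0) : E4) := by
    have := hd.hasMFDerivWithinAt.mfderivWithin (s := Iic t)
      (uniqueDiffOn_Iic t t self_mem_Iic).uniqueMDiffWithinAt
    exact DFunLike.congr_fun this (1 : ℝ)
  rw [h1, h2]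
  exact ⟨fun _ => hP t, fun _ => hP t⟩

/-- On the axis of the horizon `∂_ν` is null, because `Δ = 0` there. -/
lemma metric_horizonCurve {a m : ℝ} (ha : 0 < a) (ham : a < m) (ν₀ : S1) (s : ℝ) :
    pseudoKerrMetric a m (horizonCurve a m ν₀ s) (1, 0, 0, 0) (1, 0, 0, 0) = 0 := by
  have h : kerrDelta a m (rCoord (horizonCurve a m ν₀ s)) = 0 := kerrDelta_rOne ha ham
  have h1 := rhoSq_mul_metric (m := m) ha (horizonCurve a m ν₀ s) (1, 0, 0, 0)
  have h2 : transverse a (horizonCurve a m ν₀ s) (1, 0, 0, 0) = 0 := by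
    simp [transverse, sinhSqDPhi_apply, sinhSq, horizonCurve]
  rw [h, h2] at h1
  simpa [(rhoSq_pos ha _).ne'] using h1

lemma horizonCurve_closed (a m : ℝ) (ν₀ : S1) :
    horizonCurve a m ν₀ 0 = horizonCurve a m ν₀ (2 * Real.pi) := by
  simp only [horizonCurve, AddCircle.coe_period, AddCircle.coe_zero]

lemma isClosedNullCurve_horizonCurve {a m : ℝ} (ha : 0 < a) (ham : a < m) (ν₀ : S1) :
    (pseudoKerr a m ha).IsClosedNullCurve (horizonCurve a m ν₀) 0 (2 * Real.pi) :=
  ⟨Real.two_pi_pos, horizonCurve_closed a m ν₀, isCurveOfType_horizonCurve ν₀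
    (fun s => ⟨fun h => one_ne_zero (congrArg Prod.fst (show ((1, 0, 0, 0) : E4) = 0 from h)),
      metric_horizonCurve ha ham ν₀ s⟩) _⟩

lemma horizonCurve_subset_causalityViolatingRegion {a m : ℝ} (ha : 0 < a) (ham : a < m)
    (ν₀ : S1) : horizonCurve a m ν₀ '' Icc 0 (2 * Real.pi) ⊆
      (pseudoKerr a m ha).causalityViolatingRegion := by
  intro p hp
  refine ⟨horizonCurve a m ν₀, 0, 2 * Real.pi, Real.two_pi_pos, horizonCurve_closed a m ν₀,
    Or.inr (isCurveOfType_horizonCurve ν₀ (fun s => ⟨fun h => one_ne_zero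
      (congrArg Prod.fst (show ((1, 0, 0, 0) : E4) = 0 from h)),
      (metric_horizonCurve ha ham ν₀ s).le, ?_⟩) _), hp⟩
  have h : kerrDelta a m (rCoord (horizonCurve a m ν₀ s)) = 0 := kerrDelta_rOne ha ham
  change 0 < pseudoKerrMetric a m (horizonCurve a m ν₀ s) (pseudoKerrTimeField a m _) (1, 0, 0, 0)
  rw [pseudoKerr_timeField_apply ha, h, sinhSqDPhi_apply]
  simp

/-! ### The growth of `θ` along causal curves in `R_I` -/

/-- The primitive `ln (r - m + √Δ)` of `1 / √Δ` on `r > r₁`. It bounds the growth of `θ` along causal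
curves. -/
def logRadius (a m r : ℝ) : ℝ := Real.log (r - m + √(kerrDelta a m r))

lemma hasDerivAt_logRadius {a m r : ℝ} (ha : 0 < a) (ham : a < m) (hr : rOne a m < r) :
    HasDerivAt (logRadius a m) (√(kerrDelta a m r))⁻¹ r := by
  have hΔ := kerrDelta_pos ha ham hr
  have hrm : 0 < r - m := by linarith [rOne_sub_pos ha ham]
  have hs : 0 < √(kerrDelta a m r) := Real.sqrt_pos.2 hΔ
  have h1 : HasDerivAt (kerrDelta a m) (2 * (r - m)) r := by
    have : HasDerivAt (fun r => (r - m) ^ 2 - (m ^ 2 - a ^ 2)) (2 * (r - m)) r := by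
      simpa using (((hasDerivAt_id r).sub_const m).pow 2).sub_const (m ^ 2 - a ^ 2)
    simpa only [← kerrDelta_eq] using this
  have h2 := ((hasDerivAt_id r).sub_const m).add (h1.sqrt hΔ.ne')
  have h3 := h2.log (by simpa using (add_pos hrm hs).ne')
  have h4 := (add_pos hrm hs).ne'
  refine h3.congr_deriv ?_
  change (1 + 2 * (r - m) / (2 * √(kerrDelta a m r))) / (r - m + √(kerrDelta a m r)) = _
  field_simp
  ring

lemma logRadius_le {a m r s : ℝ} (ha : 0 < a) (ham : a < m) (hr : rOne a m < r) (hrs : r ≤ s) :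
    logRadius a m r ≤ logRadius a m s := by
  have hrm : 0 < r - m := by linarith [rOne_sub_pos ha ham]
  have := kerrDelta_mono (a := a) (sub_pos.1 hrm).le hrs
  unfold logRadius
  gcongr

lemma log_le_logRadius {a m r : ℝ} (ha : 0 < a) (ham : a < m) (hr : rOne a m < r) :
    Real.log (rOne a m - m) ≤ logRadius a m r := by
  have := rOne_sub_pos ha ham
  have := Real.sqrt_nonneg (kerrDelta a m r)
  unfold logRadius
  gcongr
  linarith

lemma hasDerivWithinAt_x {α : ℝ → M4} {s : Set ℝ} {t : ℝ} {L : ℝ →L[ℝ] E4}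
    (h : HasMFDerivWithinAt 𝓘(ℝ, ℝ) I4 α s t L) :
    HasDerivWithinAt (fun t => (α t).2.2.1) (L 1).2.2.1 s t :=
  ((ContinuousLinearMap.fst ℝ ℝ ℝ).comp
    (ContinuousLinearMap.snd ℝ ℝ (ℝ × ℝ))).hasFDerivAt.comp_hasDerivWithinAt t
    (hasDerivWithinAt_snd h)

lemma hasDerivWithinAt_y {α : ℝ → M4} {s : Set ℝ} {t : ℝ} {L : ℝ →L[ℝ] E4}
    (h : HasMFDerivWithinAt 𝓘(ℝ, ℝ) I4 α s t L) :
    HasDerivWithinAt (fun t => (α t).2.2.2) (L 1).2.2.2 s t :=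
  ((ContinuousLinearMap.snd ℝ ℝ ℝ).comp
    (ContinuousLinearMap.snd ℝ ℝ (ℝ × ℝ))).hasFDerivAt.comp_hasDerivWithinAt t
    (hasDerivWithinAt_snd h)

lemma hasDerivWithinAt_sinhSq {α : ℝ → M4} {s : Set ℝ} {t : ℝ} {L : ℝ →L[ℝ] E4}
    (h : HasMFDerivWithinAt 𝓘(ℝ, ℝ) I4 α s t L) :
    HasDerivWithinAt (fun t => sinhSq (α t))
      (2 * ((α t).2.2.1 * (L 1).2.2.1 + (α t).2.2.2 * (L 1).2.2.2)) s t := by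
  have h1 := ((hasDerivWithinAt_x h).pow 2).add ((hasDerivWithinAt_y h).pow 2)
  refine h1.congr_deriv ?_
  simp
  ring

lemma continuous_sinhSq : Continuous sinhSq := by unfold sinhSq; fun_prop

/-- Since `θ` is not smooth on the axis, its growth is estimated with `sinh² θ` replaced by
`sinh² θ + δ`. -/
lemma arsinh_sqrt_le {a m : ℝ} (ha : 0 < a) (ham : a < m) {α : ℝ → M4} {J : Set ℝ}
    (hJ : J.OrdConnected) (hα : IsCurveOfType (pseudoKerr a m ha).IsPastCausal α J) {u v δ : ℝ}
    (hu : u ∈ J) (hv : v ∈ J) (huv : u ≤ v) (h0 : α u ∈ regionI a m) (hδ : 0 < δ) :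
    Real.arsinh (√(sinhSq (α v) + δ)) ≤ Real.arsinh (√(sinhSq (α u) + δ)) +
      (logRadius a m (rCoord (α v)) - logRadius a m (rCoord (α u))) := by
  have hsub := hJ.out hu hv
  have hI : ∀ x ∈ Icc u v, α x ∈ regionI a m := by
    intro x hx
    rcases hx.1.eq_or_lt with h | h
    · rwa [← h]
    · exact lt_trans h0 (rCoord_lt_of_past ha ham hJ hα hu (hsub hx) h h0)
  have hc : ContinuousOn α (Icc u v) := hα.1.continuousOn.mono hsub
  have key := le_of_right_deriv_nonneg (u := u) (v := v)
    (f := fun x => logRadius a m (rCoord (α x)) - Real.arsinh (√(sinhSq (α x) + δ)))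
    (f' := fun x => (√(kerrDelta a m (rCoord (α x))))⁻¹ * (velRight I4 α x : E4).2.1 -
      (√(1 + √(sinhSq (α x) + δ) ^ 2))⁻¹ * (2 * ((α x).2.2.1 * (velRight I4 α x : E4).2.2.1 +
        (α x).2.2.2 * (velRight I4 α x : E4).2.2.2) / (2 * √(sinhSq (α x) + δ)))) huv ?_ ?_ ?_
  · linarith
  · refine ContinuousOn.sub (fun x hx => ?_) ?_
    · exact ContinuousAt.comp_continuousWithinAt (g := logRadius a m)
        (hasDerivAt_logRadius ha ham (hI x hx)).continuousAt
        (continuous_rCoord.comp_continuousOn hc x hx)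
    · exact Real.continuous_arsinh.comp_continuousOn (Real.continuous_sqrt.comp_continuousOn
        ((continuous_sinhSq.comp_continuousOn hc).add continuousOn_const))
  · intro x hx
    have hd := hα.1.hasMFDerivWithinAt_right hJ (hsub (Ico_subset_Icc_self hx)) hv hx.2
    have hne : sinhSq (α x) + δ ≠ 0 := by have := sinhSq_nonneg (α x); positivity
    refine HasDerivWithinAt.sub ?_ ?_
    · exact HasDerivAt.comp_hasDerivWithinAt (h₂ := logRadius a m) x
        (hasDerivAt_logRadius ha ham (hI x (Ico_subset_Icc_self hx)))
        (hasDerivWithinAt_rCoord hd)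
    · exact (((hasDerivWithinAt_sinhSq hd).add_const δ).sqrt hne).arsinh
  · intro x hx
    have hx' := Ico_subset_Icc_self hx
    have hv' := (hα.2 x (hsub hx')).1 ⟨v, hv, hx.2⟩
    have hΔ := kerrDelta_pos ha ham (hI x hx')
    have hθ := dtheta_le_of_isPastCausal ha hΔ hv'
    have hD : 0 < (velRight I4 α x : E4).2.1 := dr_pos_of_isPastCausal ha hΔ hv'
    generalize (velRight I4 α x : E4) = w at hθ hD
    have hσ := sinhSq_nonneg (α x)
    generalize sinhSq (α x) = σ at hθ hσ
    generalize (α x).2.2.1 * w.2.2.1 + (α x).2.2.2 * w.2.2.2 = S at hθ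
    generalize kerrDelta a m (rCoord (α x)) = Δ at hθ hΔ
    have hsΔ := Real.sqrt_pos.2 hΔ
    rw [Real.sq_sqrt (by positivity), mul_div_mul_left _ _ two_ne_zero, sub_nonneg]
    have hq : 0 < √(σ + δ) := Real.sqrt_pos.2 (by positivity)
    have hq1 : 0 < √(1 + (σ + δ)) := Real.sqrt_pos.2 (by positivity)
    rw [inv_mul_eq_div, inv_mul_eq_div, div_div, div_le_div_iff₀ (by positivity) hsΔ]
    refine le_of_abs_le (abs_le_of_sq_le_sq ?_ (by positivity))
    rw [mul_pow, mul_pow, mul_pow, Real.sq_sqrt hΔ.le, Real.sq_sqrt (by positivity),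
      Real.sq_sqrt (by positivity)]
    have h1 : σ * (1 + σ) ≤ (σ + δ) * (1 + (σ + δ)) := by nlinarith
    have h2 := mul_le_mul_of_nonneg_right h1 (sq_nonneg w.2.1)
    linarith

lemma thetaCoord_le_of_past {a m : ℝ} (ha : 0 < a) (ham : a < m) {α : ℝ → M4} {J : Set ℝ}
    (hJ : J.OrdConnected) (hα : IsCurveOfType (pseudoKerr a m ha).IsPastCausal α J) {u v rs θ₀ : ℝ}
    (hu : u ∈ J) (hv : v ∈ J) (huv : u ≤ v) (h0 : α u ∈ regionI a m) (hσ : sinhSq (α u) = 0)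
    (hrs : rOne a m < rs) (hvs : rCoord (α v) ≤ rs)
    (hθ : Real.log ((rs - m + √(kerrDelta a m rs)) / (rOne a m - m)) < θ₀) :
    thetaCoord (α v) ≤ θ₀ := by
  have hk := rOne_sub_pos ha ham
  have hpos : 0 < rs - m + √(kerrDelta a m rs) :=
    add_pos_of_pos_of_nonneg (by linarith) (Real.sqrt_nonneg _)
  rw [Real.log_div hpos.ne' hk.ne'] at hθ
  change logRadius a m rs - _ < _ at hθ
  -- the slack in the hypothesis on `θ₀` pays for the regularization
  set η := θ₀ - (logRadius a m rs - Real.log (rOne a m - m)) with hη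
  have hη0 : 0 < η := by linarith
  have hs : 0 < Real.sinh η := Real.sinh_pos_iff.2 hη0
  have hI : rOne a m < rCoord (α v) := by
    rcases huv.eq_or_lt with h | h
    · rwa [← h]
    · exact lt_trans h0 (rCoord_lt_of_past ha ham hJ hα hu hv h h0)
  have h1 := arsinh_sqrt_le ha ham hJ hα hu hv huv h0 (pow_pos hs 2)
  rw [hσ, zero_add, Real.sqrt_sq hs.le, Real.arsinh_sinh] at h1
  have h2 : thetaCoord (α v) ≤ Real.arsinh (√(sinhSq (α v) + Real.sinh η ^ 2)) :=
    Real.arsinh_le_arsinh.2 (Real.sqrt_le_sqrt (le_add_of_nonneg_right (by positivity)))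
  have h3 := logRadius_le ha ham hI hvs
  have h4 := log_le_logRadius ha ham h0
  linarith

/-! ### Convergence along curves of bounded variation -/

/-- A bounded function whose right derivative is dominated by that of a bounded monotone function
converges at the end of its interval of definition. -/
lemma exists_tendsto_of_right_deriv_le {J : Set ℝ} (hJ : J.OrdConnected) [Nonempty J]
    {g g' r r' : ℝ → ℝ} {C b R : ℝ}
    (hg : ContinuousOn g J) (hr : ContinuousOn r J)
    (hg' : ∀ t ∈ J, HasDerivWithinAt g (g' t) (Ici t) t)
    (hr' : ∀ t ∈ J, HasDerivWithinAt r (r' t) (Ici t) t)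
    (hr0 : ∀ t ∈ J, 0 ≤ r' t) (hle : ∀ t ∈ J, |g' t| ≤ C * r' t)
    (hb : ∀ t ∈ J, |g t| ≤ b) (hR : ∀ t ∈ J, |r t| ≤ R) :
    ∃ l, Tendsto (fun t : J => g t) atTop (𝓝 l) := by
  have conv : ∀ f f' : ℝ → ℝ, ContinuousOn f J →
      (∀ t ∈ J, HasDerivWithinAt f (f' t) (Ici t) t) → (∀ t ∈ J, 0 ≤ f' t) →
      (∃ K, ∀ t ∈ J, f t ≤ K) → ∃ l, Tendsto (fun t : J => f t) atTop (𝓝 l) := by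
    rintro f f' hf hf' h0 ⟨K, hK⟩
    refine ⟨_, tendsto_atTop_ciSup (fun s t hst => ?_) ⟨K, ?_⟩⟩
    · have hsub := hJ.out s.2 t.2
      exact le_of_right_deriv_nonneg hst (hf.mono hsub)
        (fun x hx => hf' x (hsub (Ico_subset_Icc_self hx)))
        (fun x hx => h0 x (hsub (Ico_subset_Icc_self hx)))
    · rintro _ ⟨t, rfl⟩
      exact hK t t.2
  obtain ⟨l₁, h1⟩ := conv r r' hr hr' hr0 ⟨R, fun t ht => (abs_le.1 (hR t ht)).2⟩
  obtain ⟨l₂, h2⟩ := conv (fun t => g t + C * r t) (fun t => g' t + C * r' t)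
    (hg.add (continuousOn_const.mul hr)) (fun t ht => (hg' t ht).add ((hr' t ht).const_mul C))
    (fun t ht => by linarith [(abs_le.1 (hle t ht)).1])
    ⟨b + |C| * R, fun t ht => by
      have h3 := (le_abs_self _).trans_eq (abs_mul C (r t))
      have h4 := mul_le_mul_of_nonneg_left (hR t ht) (abs_nonneg C)
      linarith [(abs_le.1 (hb t ht)).2]⟩
  refine ⟨l₂ - C * l₁, (h2.sub (h1.const_mul C)).congr fun t => ?_⟩
  ring

/-- A point of the circle that depends on a parameter converges if its cosine and its sine do. -/
lemma exists_tendsto_of_cos_sin {ι : Type*} {l : Filter ι} [l.NeBot] {f : ι → Real.Angle} {c s : ℝ}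
    (hc : Tendsto (fun i => (f i).cos) l (𝓝 c)) (hs : Tendsto (fun i => (f i).sin) l (𝓝 s)) :
    ∃ q, Tendsto f l (𝓝 q) := by
  have : Fact (0 < 2 * Real.pi) := ⟨Real.two_pi_pos⟩
  have : CompactSpace Real.Angle := inferInstanceAs (CompactSpace (AddCircle (2 * Real.pi)))
  have lim : ∀ q, ClusterPt q (map f l) → q.cos = c ∧ q.sin = s := by
    intro q hq
    constructor
    · have h1 : ClusterPt q.cos (map (fun i => (f i).cos) l) :=
        hq.map Real.Angle.continuous_cos.continuousAt tendsto_map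
      exact (eq_of_nhds_neBot (h1.mono hc)).symm ▸ rfl
    · have h1 : ClusterPt q.sin (map (fun i => (f i).sin) l) :=
        hq.map Real.Angle.continuous_sin.continuousAt tendsto_map
      exact (eq_of_nhds_neBot (h1.mono hs)).symm ▸ rfl
  obtain ⟨q, hq⟩ := exists_clusterPt_of_compactSpace (map f l)
  refine ⟨q, le_nhds_of_unique_clusterPt fun q' hq' => ?_⟩
  obtain ⟨h1, h2⟩ := lim q hq
  obtain ⟨h3, h4⟩ := lim q' hq'
  induction q using Real.Angle.induction_on with | _ x
  induction q' using Real.Angle.induction_on with | _ y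
  rw [Real.Angle.cos_coe] at h1 h3
  rw [Real.Angle.sin_coe] at h2 h4
  exact Real.Angle.cos_sin_inj (h3.trans h1.symm) (h4.trans h2.symm)

/-! ### Points of the future domain of dependence -/

lemma halfOpen_ordConnected (B : EReal) : (halfOpen B).OrdConnected :=
  ⟨fun _ hs _ ht _ hx =>
    ⟨hs.1.trans hx.1, lt_of_le_of_lt (EReal.coe_le_coe_iff.2 hx.2) ht.2⟩⟩

lemma halfOpen_exists_gt {B : EReal} {t : ℝ} (ht : t ∈ halfOpen B) : ∃ u ∈ halfOpen B, t < u := by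
  obtain ⟨u, h1, h2⟩ := EReal.lt_iff_exists_real_btwn.1 ht.2
  have h1' := EReal.coe_lt_coe_iff.1 h1
  exact ⟨u, ⟨ht.1.trans h1'.le, h2⟩, h1'⟩

lemma isEndpoint_of_tendsto {M : Type*} [TopologicalSpace M] {α : ℝ → M} {B : EReal} {q : M}
    [Nonempty (halfOpen B)] (h : Tendsto (fun t : halfOpen B => α t) atTop (𝓝 q)) :
    IsEndpoint α B q := by
  intro U hU
  obtain ⟨t₀, ht₀⟩ := mem_atTop_sets.1 (h hU)
  exact ⟨t₀, t₀.2, fun t ht hle => ht₀ ⟨t, ht⟩ hle⟩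

/-- A past causal curve in `R_I` that stays below `r = rs` and where `θ` is bounded has an endpoint:
its coordinate velocity is dominated by `dr / dt`, and `r` is bounded. -/
lemma exists_isEndpoint {a m : ℝ} (ha : 0 < a) (ham : a < m) {α : ℝ → M4} {B : EReal} (hB : 0 < B)
    (hα : IsCurveOfType (pseudoKerr a m ha).IsPastCausal α (halfOpen B))
    (h0 : α 0 ∈ regionI a m) {rs S : ℝ} (hrs : ∀ t ∈ halfOpen B, rCoord (α t) ≤ rs)
    (hS : ∀ t ∈ halfOpen B, sinhSq (α t) ≤ S) : ∃ q, IsEndpoint α B q := by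
  have hJ := halfOpen_ordConnected B
  have hJ0 : (0 : ℝ) ∈ halfOpen B := ⟨le_rfl, hB⟩
  have : Nonempty (halfOpen B) := ⟨⟨0, hJ0⟩⟩
  have hr1 : 0 < rOne a m := by linarith [rOne_sub_pos ha ham]
  have hr : ∀ t ∈ halfOpen B, rCoord (α 0) ≤ rCoord (α t) := by
    intro t ht
    rcases ht.1.eq_or_lt with h | h
    · rw [← h]
    · exact (rCoord_lt_of_past ha ham hJ hα hJ0 ht h h0).le
  have h0' : rOne a m < rCoord (α 0) := h0
  have hpos : ∀ t ∈ halfOpen B, 0 < rCoord (α t) := fun t ht =>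
    hr1.trans (h0'.trans_le (hr t ht))
  obtain ⟨C, hC⟩ := exists_bound_of_isPastCausal (m := m) ha (kerrDelta_pos ha ham h0)
    (rs ^ 2 + a ^ 2 * (1 + S)) S
  have hd := fun t ht => (halfOpen_exists_gt (t := t) ht).elim fun u hu =>
    hα.1.hasMFDerivWithinAt_right hJ ht hu.1 hu.2
  have hv : ∀ t ∈ halfOpen B, (pseudoKerr a m ha).IsPastCausal (α t) (velRight I4 α t) :=
    fun t ht => (hα.2 t ht).1 (halfOpen_exists_gt ht)
  have hD : ∀ t ∈ halfOpen B, 0 ≤ (velRight I4 α t : E4).2.1 := fun t ht =>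
    (dr_pos_of_isPastCausal ha (kerrDelta_pos ha ham (h0'.trans_le (hr t ht))) (hv t ht)).le
  have hbd := fun t ht => hC (α t) (velRight I4 α t) (hv t ht)
    (kerrDelta_mono (by linarith [rOne_sub_pos ha ham]) (hr t ht))
    (by
      unfold rhoSq
      have := pow_le_pow_left₀ (hpos t ht).le (hrs t ht) 2
      have := mul_le_mul_of_nonneg_left (hS t ht) (sq_nonneg a)
      linarith) (hS t ht)
  have hcont := hα.1.continuousOn
  have hcr : ContinuousOn (fun t => rCoord (α t)) (halfOpen B) :=
    continuous_rCoord.comp_continuousOn hcont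
  have hRb : ∀ t ∈ halfOpen B, |rCoord (α t)| ≤ rs := fun t ht => by
    rw [abs_of_pos (hpos t ht)]
    exact hrs t ht
  have conv : ∀ (g g' : ℝ → ℝ) (K b : ℝ), ContinuousOn g (halfOpen B) →
      (∀ t ∈ halfOpen B, HasDerivWithinAt g (g' t) (Ici t) t) →
      (∀ t ∈ halfOpen B, |g' t| ≤ K * (velRight I4 α t : E4).2.1) →
      (∀ t ∈ halfOpen B, |g t| ≤ b) → ∃ l, Tendsto (fun t : halfOpen B => g t) atTop (𝓝 l) :=
    fun g g' K b h1 h2 h3 h4 => exists_tendsto_of_right_deriv_le hJ (r := fun t => rCoord (α t))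
      (r' := fun t => (velRight I4 α t : E4).2.1) h1 hcr h2
      (fun t ht => hasDerivWithinAt_rCoord (hd t ht)) hD h3 h4 hRb
  obtain ⟨r, hrlim⟩ := conv (fun t => rCoord (α t)) (fun t => (velRight I4 α t : E4).2.1) 1 rs hcr
    (fun t ht => hasDerivWithinAt_rCoord (hd t ht))
    (fun t ht => by rw [abs_of_nonneg (hD t ht), one_mul]) hRb
  obtain ⟨x, hx⟩ := conv (fun t => (α t).2.2.1) (fun t => (velRight I4 α t : E4).2.2.1) C (√S)
    (by fun_prop) (fun t ht => hasDerivWithinAt_x (hd t ht)) (fun t ht => (hbd t ht).2.1)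
    (fun t ht => Real.abs_le_sqrt (by have := hS t ht; unfold sinhSq at this; nlinarith))
  obtain ⟨y, hy⟩ := conv (fun t => (α t).2.2.2) (fun t => (velRight I4 α t : E4).2.2.2) C (√S)
    (by fun_prop) (fun t ht => hasDerivWithinAt_y (hd t ht)) (fun t ht => (hbd t ht).2.2)
    (fun t ht => Real.abs_le_sqrt (by have := hS t ht; unfold sinhSq at this; nlinarith))
  -- a real lift of the coordinate `ν`, used only to name the derivatives of `cos ν` and `sin ν`
  choose ξ hξ using fun t => QuotientAddGroup.mk_surjective (α t).1
  have hle : ∀ t ∈ halfOpen B, ∀ k : ℝ, |k| ≤ 1 →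
      |k * (velRight I4 α t : E4).1| ≤ C * (velRight I4 α t : E4).2.1 := fun t ht k hk => by
    rw [abs_mul]
    exact (mul_le_of_le_one_left (abs_nonneg _) hk).trans (hbd t ht).1
  obtain ⟨c, hc⟩ := conv (fun t => Real.Angle.cos (α t).1)
    (fun t => -Real.sin (ξ t) * (velRight I4 α t : E4).1) C 1
    (Real.Angle.continuous_cos.comp_continuousOn (continuous_fst.comp_continuousOn hcont))
    (fun t ht => hasDerivWithinAt_comp_fst Real.Angle.cos_coe Real.hasDerivAt_cos (hd t ht) (hξ t))
    (fun t ht => hle t ht _ (by rw [abs_neg]; exact Real.abs_sin_le_one _))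
    (fun t _ => by
      rw [← hξ t]
      exact (congrArg abs (Real.Angle.cos_coe (ξ t))).trans_le (Real.abs_cos_le_one _))
  obtain ⟨s, hs⟩ := conv (fun t => Real.Angle.sin (α t).1)
    (fun t => Real.cos (ξ t) * (velRight I4 α t : E4).1) C 1
    (Real.Angle.continuous_sin.comp_continuousOn (continuous_fst.comp_continuousOn hcont))
    (fun t ht => hasDerivWithinAt_comp_fst Real.Angle.sin_coe Real.hasDerivAt_sin (hd t ht) (hξ t))
    (fun t ht => hle t ht _ (Real.abs_cos_le_one _))
    (fun t _ => by
      rw [← hξ t]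
      exact (congrArg abs (Real.Angle.sin_coe (ξ t))).trans_le (Real.abs_sin_le_one _))
  obtain ⟨ν, hν⟩ := exists_tendsto_of_cos_sin hc hs
  have hν' : Tendsto (fun t : halfOpen B => (α t).1) atTop (𝓝 (show S1 from ν)) := hν
  exact ⟨(show S1 from ν, r, x, y), isEndpoint_of_tendsto
    (hν'.prodMk_nhds (hrlim.prodMk_nhds (hx.prodMk_nhds hy)))⟩

lemma mem_futureDomainOfDependence_cap {a m : ℝ} (ha : 0 < a) (ham : a < m) {rs θ₀ r : ℝ}
    (hrs : rOne a m < rs)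
    (hθ : Real.log ((rs - m + √(kerrDelta a m rs)) / (rOne a m - m)) < θ₀)
    (hr : rOne a m < r) (hrr : r < rs) (ν : S1) :
    ((ν, r, 0, 0) : M4) ∈ (pseudoKerr a m ha).futureDomainOfDependence (cap rs θ₀) := by
  intro B α hB hα h0 hno
  by_contra! hmiss
  have hJ := halfOpen_ordConnected B
  have hJ0 : (0 : ℝ) ∈ halfOpen B := ⟨le_rfl, hB⟩
  have hI : α 0 ∈ regionI a m := by rw [h0]; exact hr
  have hσ0 : sinhSq (α 0) = 0 := by rw [h0]; simp [sinhSq]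
  have hθle := fun t (ht : t ∈ halfOpen B) (hle : rCoord (α t) ≤ rs) =>
    thetaCoord_le_of_past ha ham hJ hα hJ0 ht ht.1 hI hσ0 hrs hle hθ
  have hlt : ∀ t ∈ halfOpen B, rCoord (α t) ≤ rs := by
    intro t ht
    by_contra! hgt
    have hsub := hJ.out hJ0 ht
    obtain ⟨u, hu, hur⟩ := intermediate_value_Icc ht.1
      (continuous_rCoord.comp_continuousOn (hα.1.continuousOn.mono hsub))
      (show rs ∈ Icc _ _ from ⟨by simpa [h0, rCoord] using hrr.le, hgt.le⟩)
    exact hmiss u (hsub hu) ⟨hur, hθle u (hsub hu) (le_of_eq hur)⟩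
  refine hno (exists_isEndpoint ha ham hB hα hI hlt (S := Real.sinh θ₀ ^ 2) fun t ht => ?_)
  exact (Real.sqrt_le_left (Real.sqrt_nonneg _ |>.trans
    ((thetaCoord_le_iff _).1 (hθle t ht (hlt t ht))))).1
    ((thetaCoord_le_iff _).1 (hθle t ht (hlt t ht)))

lemma closure_futureDomainOfDependence_cap {a m : ℝ} (ha : 0 < a) (ham : a < m) {rs θ₀ : ℝ}
    (hrs : rOne a m < rs)
    (hθ : Real.log ((rs - m + √(kerrDelta a m rs)) / (rOne a m - m)) < θ₀) (ν₀ : S1) :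
    horizonCurve a m ν₀ 0 ∈
      closure ((pseudoKerr a m ha).futureDomainOfDependence (cap rs θ₀)) := by
  have hc : Continuous fun r : ℝ => ((ν₀, r, 0, 0) : M4) := by fun_prop
  have h1 : horizonCurve a m ν₀ 0 = (ν₀, rOne a m, 0, 0) := by
    simp [horizonCurve]
  rw [h1]
  refine mem_closure_of_tendsto (b := 𝓝[>] rOne a m)
    ((hc.tendsto (rOne a m)).mono_left nhdsWithin_le_nhds) ?_
  filter_upwards [Ioo_mem_nhdsGT hrs] with r hr
  exact mem_futureDomainOfDependence_cap ha ham hrs hθ hr.1 hr.2 ν₀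

end TimeMachine

end

theorem proposition7 (a m : ℝ) (ha : 0 < a) (ham : a < m) :
    (TimeMachine.pseudoKerr a m ha).HasTMStructure ∧
    IsOpen (TimeMachine.regionI a m) ∧
    (TimeMachine.pseudoKerr a m ha).CausalityHoldsOn (TimeMachine.regionI a m) ∧
    (∀ ν₀ : TimeMachine.S1,
      (TimeMachine.pseudoKerr a m ha).IsClosedNullCurve
        (TimeMachine.horizonCurve a m ν₀) 0 (2 * Real.pi) ∧
      TimeMachine.horizonCurve a m ν₀ '' Set.Icc 0 (2 * Real.pi) ⊆
        TimeMachine.horizonOne a m ∩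
          (TimeMachine.pseudoKerr a m ha).causalityViolatingRegion) ∧
    ∀ rs : ℝ, TimeMachine.rOne a m < rs →
      (TimeMachine.pseudoKerr a m ha).IsSpacelikeHypersurface (TimeMachine.levelSet rs) ∧
      TimeMachine.levelSet rs ⊆ TimeMachine.regionI a m ∧
      ∀ θ₀ : ℝ,
        Real.log ((rs - m + Real.sqrt (TimeMachine.kerrDelta a m rs)) /
          (TimeMachine.rOne a m - m)) < θ₀ →
        TimeMachine.cap rs θ₀ ⊆ TimeMachine.levelSet rs ∧
        IsCompact (TimeMachine.cap rs θ₀) ∧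
        (TimeMachine.pseudoKerr a m ha).IsAchronal (TimeMachine.cap rs θ₀) ∧
        ∀ ν₀ : TimeMachine.S1,
          (closure ((TimeMachine.pseudoKerr a m ha).futureDomainOfDependence
              (TimeMachine.cap rs θ₀)) ∩
            TimeMachine.horizonCurve a m ν₀ '' Set.Icc 0 (2 * Real.pi)).Nonempty := by
  open TimeMachine in
  have hmem : ∀ ν₀ : S1, horizonCurve a m ν₀ 0 ∈
      horizonCurve a m ν₀ '' Set.Icc 0 (2 * Real.pi) := fun ν₀ =>
    ⟨0, Set.left_mem_Icc.2 Real.two_pi_pos.le, rfl⟩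
  have hcap : ∀ rs θ₀ : ℝ, cap rs θ₀ ⊆ levelSet rs := fun rs θ₀ p hp => hp.1
  refine ⟨?_, isOpen_regionI a m, causalityHoldsOn_regionI ha ham, fun ν₀ =>
    ⟨isClosedNullCurve_horizonCurve ha ham ν₀, Set.subset_inter ?_
      (horizonCurve_subset_causalityViolatingRegion ha ham ν₀)⟩,
    fun rs hrs => ⟨isSpacelikeHypersurface_levelSet ha ham hrs, levelSet_subset_regionI hrs,
      fun θ₀ hθ => ⟨hcap rs θ₀, isCompact_cap rs θ₀, isAchronal_cap ha ham hrs θ₀, fun ν₀ =>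
        ⟨horizonCurve a m ν₀ 0, closure_futureDomainOfDependence_cap ha ham hrs hθ ν₀,
          hmem ν₀⟩⟩⟩⟩
  · have hrs : rOne a m < rOne a m + 1 := lt_add_one _
    refine ⟨regionI a m, isOpen_regionI a m, causalityHoldsOn_regionI ha ham,
      levelSet (rOne a m + 1), isSpacelikeHypersurface_levelSet ha ham hrs,
      levelSet_subset_regionI hrs, cap (rOne a m + 1) _, hcap _ _, isAchronal_cap ha ham hrs _,
      isCompact_cap _ _, horizonCurve a m 0 0,
      closure_futureDomainOfDependence_cap ha ham hrs (lt_add_one _) 0,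
      horizonCurve_subset_causalityViolatingRegion ha ham 0 (hmem 0)⟩
  · rintro _ ⟨s, -, rfl⟩
    rfl
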